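/- Let $\Bbbk$ be a field, $H$ a Hopf algebra over $\Bbbk$ with bijective antipode $\mathcal S$, and $W$ a finite-dimensional left Yetter–Drinfeld module over $H$, with coaction $\delta(v)=v_{(-1)}\otimes v_{(0)}$ and $\delta(h\cdot v)=h_{(1)}v_{(-1)}\mathcal S(h_{(3)})\otimes h_{(2)}\cdot v_{(0)}$. The dual $W^*=\operatorname{Hom}(W,\Bbbk)$ carries the coaction $f\mapsto f_{(-1)}\otimes f_{(0)}$ determined by $f_{(-1)}\langle f_{(0)},v\rangle=\mathcal S^{-1}(v_{(-1)})\langle f,v_{(0)}\rangle$. The tensor algebra $T(W)$ is a braided Hopf algebra: $H$ acts and coacts diagonally, and $\Delta$ is the algebra map to the braided tensor product $T(W)\underline{\otimes}T(W)$, whose product is $(a\otimes b)(c\otimes d)=a(b_{(-1)}\cdot c)\otimes b_{(0)}d$, with $\Delta(w)=w\otimes1+1\otimes w$ for $w\in W$; its counit vanishes on $W$, and $T(W)^+$ denotes the kernel of the counit. Let $\mathfrak J(W)$ be the sum of all homogeneous two-sided ideals of $T(W)$ that are contained in $\bigoplus_{n\ge2}T^n(W)$, are Yetter–Drinfeld submodules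 and are coideals ($\Delta(I)\subseteq I\otimes T(W)+T(W)\otimes I$). Let $\mathcal B(W)=T(W)/\mathfrak J(W)$ be the Nichols algebra of $W$, with the induced structure. For $f\in W^*$ let $\partial_f\in\operatorname{End}\mathcal B(W)$ be the canonical braided derivation $\partial_f(x)=\langle f,x^{[1]}\rangle x^{[2]}$, where $x^{[1]}\otimes x^{[2]}=c^{-1}(\Delta(x))$, $c^{-1}(x\otimes y)=y_{(0)}\otimes\mathcal S^{-1}(y_{(-1)})\cdot x$, and $f$ is extended to $\mathcal B(W)$ by zero outside $\mathcal B^1(W)=W$. Let $I\subseteq T(W)^+$ be a two-sided ideal of $T(W)$ stable under the action of $H$, let $R=T(W)/I$, and let $\pi:T(W)\to R$ be the projection. Consider families $(d_f)_{f\in W^*}$ of linear endomorphisms of $R$ such that for all $f\in W^*$, $x,y\in R$, $v\in W$ $$(\ast)\qquad d_f(xy)=(f_{(-1)}\cdot x)\,d_{f_{(0)}}(y)+d_f(x)\,y,\qquad d_f(\pi(v))=\langle f,v\rangle ,$$ where the first identity means $d_f(xy)=\sum_i (h_i\cdot x)\,d_{g_i}(y)+d_f(x)y$ for every expression $\sum_i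 h_i\otimes g_i$ of $f_{(-1)}\otimes f_{(0)}\in H\otimes W^*$. (i) If $I$ is a homogeneous Hopf ideal (that is, homogeneous, a coideal with zero counit, and stable under the antipode of $T(W)$) and $I\cap W=0$, then a family satisfying $(\ast)$ exists. (ii) Conversely, if $(d_f)_{f\in W^*}$ is a family satisfying $(\ast)$, then $I\subseteq\mathfrak J(W)$. That is, there is a surjective algebra map $\Omega:R\to\mathcal B(W)$ with $\Omega(\pi(w))=w$ for all $w\in W$, and it is the only algebra map with this property on $W$. Moreover $\Omega\, d_f=\partial_f\,\Omega$ for all $f\in W^*$. -/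

import Mathlib

open scoped TensorProduct

noncomputable section

namespace YD

universe u v w

/-! ### Yetter–Drinfeld modules -/

section Basic

variable (k : Type u) (H : Type v) [Field k] [Ring H] [HopfAlgebra k H]

/-- The antipode `S` of `H`, bijective by assumption, as a linear automorphism of `H`. -/
def antipodeEquiv (hS : Function.Bijective (HopfAlgebra.antipode k (A := H))) : H ≃ₗ[k] H :=
  LinearEquiv.ofBijective (HopfAlgebra.antipode k (A := H)) hS

variable {k H}

/-- For an action `act` of `H` on `V`, the linear map
`a ⊗ (b ⊗ c) ↦ (g ⊗ v ↦ a g S(c) ⊗ b · v)`. -/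
def conjAct {V : Type w} [AddCommGroup V] [Module k V] (act : H →ₗ[k] Module.End k V) :
    H ⊗[k] (H ⊗[k] H) →ₗ[k] Module.End k (H ⊗[k] V) :=
  TensorProduct.lift ((TensorProduct.mapBilinear (RingHom.id k) H V H V).compl₁₂
      (TensorProduct.lift ((LinearMap.llcomp k H H H).compl₁₂ (LinearMap.mul k H)
        ((LinearMap.mul k H).flip ∘ₗ HopfAlgebra.antipode k (A := H)))) act) ∘ₗ
    (TensorProduct.assoc k H H H).symm.toLinearMap ∘ₗ
      (TensorProduct.comm k H H).toLinearMap.lTensor H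

theorem conjAct_tmul {V : Type w} [AddCommGroup V] [Module k V] (act : H →ₗ[k] Module.End k V)
    (a b c g : H) (v : V) : conjAct act (a ⊗ₜ (b ⊗ₜ c)) (g ⊗ₜ v) =
      (a * g * HopfAlgebra.antipode k c) ⊗ₜ[k] act b v := by
  simp [conjAct, mul_assoc]

end Basic

/-- A left Yetter–Drinfeld module structure over the Hopf algebra `H` on the vector space `V`:
a left action `h · v = act h v`, and a coassociative and counital left coaction
`coact v = v₍₋₁₎ ⊗ v₍₀₎`, such that `coact (h · v) = h₍₁₎ v₍₋₁₎ S(h₍₃₎) ⊗ h₍₂₎ · v₍₀₎`. -/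
structure YetterDrinfeld (k : Type u) (H : Type v) (V : Type w) [Field k] [Ring H]
    [HopfAlgebra k H] [AddCommGroup V] [Module k V] where
  act : H →ₐ[k] Module.End k V
  coact : V →ₗ[k] H ⊗[k] V
  counit_coact : ∀ v, TensorProduct.lid k V ((Coalgebra.counit (R := k)).rTensor V (coact v)) = v
  coassoc_coact : ∀ v, TensorProduct.assoc k H H V ((Coalgebra.comul (R := k)).rTensor V (coact v))
    = coact.lTensor H (coact v)
  coact_act : ∀ h v, coact (act h v) =
    conjAct act.toLinearMap ((Coalgebra.comul (R := k)).lTensor H (Coalgebra.comul (R := k) h))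
      (coact v)

/-! ### Braided linear algebra for a space with action and coaction -/

section Braided

variable {k : Type u} {H : Type v} [Field k] [Ring H] [HopfAlgebra k H]
variable {B : Type w} [Ring B] [Algebra k B]

/-- The inverse braiding `c⁻¹(x ⊗ y) = y₍₀₎ ⊗ S⁻¹(y₍₋₁₎) · x` on `B ⊗ B`. -/
def invBraiding (hS : Function.Bijective (HopfAlgebra.antipode k (A := H)))
    (act : H →ₗ[k] Module.End k B) (coact : B →ₗ[k] H ⊗[k] B) : B ⊗[k] B →ₗ[k] B ⊗[k] B :=
  TensorProduct.lift <| LinearMap.mk₂ k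
    (fun x y => TensorProduct.comm k B B
      ((act.flip x ∘ₗ (antipodeEquiv k H hS).symm.toLinearMap).rTensor B (coact y)))
    (fun x x' y => by rw [map_add, LinearMap.add_comp, LinearMap.rTensor_add,
      LinearMap.add_apply, map_add])
    (fun r x y => by rw [map_smul, LinearMap.smul_comp, LinearMap.rTensor_smul,
      LinearMap.smul_apply, map_smul])
    (fun x y y' => by rw [map_add, map_add, map_add])
    (fun r x y => by rw [map_smul, map_smul, map_smul])

/-- The operator `x ↦ ⟨ξ, x^[1]⟩ x^[2]`, where `x^[1] ⊗ x^[2] = c⁻¹(Δ(x))`, for a linear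
form `ξ`, on a space with action `act`, coaction `coact` and comultiplication `comul`. -/
def quantumDiff (hS : Function.Bijective (HopfAlgebra.antipode k (A := H)))
    (act : H →ₗ[k] Module.End k B) (coact : B →ₗ[k] H ⊗[k] B) (comul : B →ₗ[k] B ⊗[k] B)
    (ξ : Module.Dual k B) : Module.End k B :=
  (TensorProduct.lid k B).toLinearMap ∘ₗ ξ.rTensor B ∘ₗ invBraiding hS act coact ∘ₗ comul

/-- The product of the braided tensor product algebra,
`(a ⊗ b)(c ⊗ d) = a (b₍₋₁₎ · c) ⊗ b₍₀₎ d`. -/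
def braidedMul (act : H →ₗ[k] Module.End k B) (coact : B →ₗ[k] H ⊗[k] B) :
    B ⊗[k] B →ₗ[k] Module.End k (B ⊗[k] B) :=
  TensorProduct.lift <| LinearMap.mk₂ k
    (fun a b => (LinearMap.mulLeft k a).rTensor B ∘ₗ
      TensorProduct.lift ((TensorProduct.mapBilinear (RingHom.id k) B B B B).compl₁₂ act
        (LinearMap.mul k B)) (coact b))
    (fun a a' b => by
      rw [show LinearMap.mulLeft k (a + a') = LinearMap.mulLeft k a + LinearMap.mulLeft k a' by
        ext; simp [add_mul], LinearMap.rTensor_add, LinearMap.add_comp])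
    (fun r a b => by
      rw [show LinearMap.mulLeft k (r • a) = r • LinearMap.mulLeft k a by ext; simp,
        LinearMap.rTensor_smul, LinearMap.smul_comp])
    (fun a b b' => by rw [map_add, map_add, LinearMap.comp_add])
    (fun r a b => by rw [map_smul, map_smul, LinearMap.comp_smul])

theorem invBraiding_tmul (hS : Function.Bijective (HopfAlgebra.antipode k (A := H)))
    (act : H →ₗ[k] Module.End k B) (coact : B →ₗ[k] H ⊗[k] B) (x y : B) :
    invBraiding hS act coact (x ⊗ₜ y) = TensorProduct.comm k B B
      ((act.flip x ∘ₗ (antipodeEquiv k H hS).symm.toLinearMap).rTensor B (coact y)) := rfl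

end Braided

namespace YetterDrinfeld

section

variable {k : Type u} {H : Type v} {W : Type w} [Field k] [Ring H] [HopfAlgebra k H]
  [AddCommGroup W] [Module k W] (Y : YetterDrinfeld k H W)

/-- The coaction of the right dual `W^*`, determined by
`f₍₋₁₎ ⟨f₍₀₎, v⟩ = S⁻¹(v₍₋₁₎) ⟨f, v₍₀₎⟩`: the linear map `v ↦ S⁻¹(v₍₋₁₎) ⟨f, v₍₀₎⟩` from `W`
to `H` is viewed as an element of `H ⊗ W^*`. -/
def dualCoact [FiniteDimensional k W]
    (hS : Function.Bijective (HopfAlgebra.antipode k (A := H))) (f : Module.Dual k W) :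
    H ⊗[k] Module.Dual k W :=
  TensorProduct.comm k (Module.Dual k W) H
    ((dualTensorHomEquiv (R := k) (M := W) (N := H)).symm
      ((antipodeEquiv k H hS).symm.toLinearMap ∘ₗ (TensorProduct.rid k H).toLinearMap ∘ₗ
        f.lTensor H ∘ₗ Y.coact))

/-! ### The braided Hopf algebra `T(W)` -/

/-- The diagonal action of `H` on `T(W)`: it extends the action on `W` and satisfies
`h · 1 = ε(h) 1` and `h · (x y) = (h₍₁₎ · x) (h₍₂₎ · y)`. That is, `x ↦ (h ↦ h · x)` is the
algebra map from `T(W)` to the convolution algebra `Hom(H, T(W))` extending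
`w ↦ (h ↦ h · w)`. -/
def tensorAct : H →ₗ[k] Module.End k (TensorAlgebra k W) :=
  LinearMap.flip <| (WithConv.linearEquiv k (H →ₗ[k] TensorAlgebra k W)).toLinearMap ∘ₗ
    (TensorAlgebra.lift k ((WithConv.linearEquiv k (H →ₗ[k] TensorAlgebra k W)).symm.toLinearMap ∘ₗ
      (Y.act.toLinearMap.compr₂ₛₗ (TensorAlgebra.ι k)).flip)).toLinearMap

/-- The diagonal coaction of `H` on `T(W)`: the algebra map `T(W) → H ⊗ T(W)` extending the
coaction of `W`. -/
def tensorCoact : TensorAlgebra k W →ₗ[k] H ⊗[k] TensorAlgebra k W :=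
  (TensorAlgebra.lift k ((TensorAlgebra.ι k).lTensor H ∘ₗ Y.coact)).toLinearMap

/-- The comultiplication of `T(W)`: the algebra map to the braided tensor product algebra
`T(W) ⊗ T(W)` with `Δ(w) = w ⊗ 1 + 1 ⊗ w` for `w ∈ W`. In other words
`Δ(w₁ ⋯ wₙ) = (w₁ ⊗ 1 + 1 ⊗ w₁) ⋯ (wₙ ⊗ 1 + 1 ⊗ wₙ) (1 ⊗ 1)`, with the braided product. -/
def tensorComul : TensorAlgebra k W →ₗ[k] TensorAlgebra k W ⊗[k] TensorAlgebra k W :=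
  (TensorAlgebra.lift k (braidedMul Y.tensorAct Y.tensorCoact ∘ₗ
    ((TensorProduct.mk k _ _).flip 1 + TensorProduct.mk k _ _ 1) ∘ₗ
      TensorAlgebra.ι k)).toLinearMap.flip (1 ⊗ₜ 1)

/-- An antipode of the braided bialgebra `T(W)` (unique if it exists): a convolution inverse of
the identity. The counit of `T(W)` is `TensorAlgebra.algebraMapInv`, which vanishes on `W`. -/
def IsTensorAntipode (S : Module.End k (TensorAlgebra k W)) : Prop :=
  LinearMap.mul' k _ ∘ₗ S.rTensor _ ∘ₗ Y.tensorComul =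
      Algebra.linearMap k _ ∘ₗ TensorAlgebra.algebraMapInv.toLinearMap ∧
    LinearMap.mul' k _ ∘ₗ S.lTensor _ ∘ₗ Y.tensorComul =
      Algebra.linearMap k _ ∘ₗ TensorAlgebra.algebraMapInv.toLinearMap

end

/-! ### Ideals of `T(W)` and their quotients -/

section Ideals

variable {k : Type u} {H : Type v} {W : Type w} [Field k] [Ring H] [HopfAlgebra k H]
  [AddCommGroup W] [Module k W] (Y : YetterDrinfeld k H W)

/-- `I` is stable under the action of `H`. -/
def IsActStable (I : Ideal (TensorAlgebra k W)) : Prop :=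
  ∀ h : H, ∀ x ∈ I, Y.tensorAct h x ∈ I

/-- `I` is a subcomodule: the coaction maps `I` to `H ⊗ I`. -/
def IsCoactStable (I : Ideal (TensorAlgebra k W)) : Prop :=
  ∀ x ∈ I, Y.tensorCoact x ∈ LinearMap.range ((I.restrictScalars k).subtype.lTensor H)

/-- `Δ(I) ⊆ I ⊗ T(W) + T(W) ⊗ I`. -/
def IsComulStable (I : Ideal (TensorAlgebra k W)) : Prop :=
  ∀ x ∈ I, Y.tensorComul x ∈
    LinearMap.range ((I.restrictScalars k).subtype.rTensor (TensorAlgebra k W)) ⊔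
      LinearMap.range ((I.restrictScalars k).subtype.lTensor (TensorAlgebra k W))

/-- The (two-sided) ideal `I` is homogeneous for the grading `T(W) = ⨁ₙ Tⁿ(W)`, where `Tⁿ(W)` is
the `n`-th power of the subspace `W`. -/
def IsHomogeneousIdeal (I : Ideal (TensorAlgebra k W)) : Prop :=
  I.IsHomogeneous (fun n : ℕ => LinearMap.range (TensorAlgebra.ι k : W →ₗ[k] _) ^ n)

/-- The two-sided ideal `I` is a Hopf ideal of the braided Hopf algebra `T(W)`: it is a coideal
and is stable under the antipode. (Stability under the action is a separate standing
assumption; stability under the coaction is not required here.) -/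
def IsHopfIdeal (I : Ideal (TensorAlgebra k W)) : Prop :=
  Y.IsComulStable I ∧ (∀ x ∈ I, TensorAlgebra.algebraMapInv x = 0) ∧
    ∃ S, Y.IsTensorAntipode S ∧ ∀ x ∈ I, S x ∈ I

/-- The two-sided ideals used to define the Nichols algebra: homogeneous ideals contained in
`⨁_{n ≥ 2} Tⁿ(W)` (`algebraMapInv` and `ιInv` are the projections to the components of degree
`0` and `1`), which are Yetter–Drinfeld submodules and coideals. -/
structure IsNicholsRelationIdeal (I : Ideal (TensorAlgebra k W)) : Prop where
  isTwoSided : I.IsTwoSided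
  homogeneous : IsHomogeneousIdeal I
  degree_zero : ∀ x ∈ I, TensorAlgebra.algebraMapInv x = 0
  degree_one : ∀ x ∈ I, TensorAlgebra.ιInv x = 0
  act_mem : Y.IsActStable I
  coact_mem : Y.IsCoactStable I
  comul_mem : Y.IsComulStable I

/-- The ideal `𝔍(W)` of relations of the Nichols algebra: the sum of all homogeneous two-sided
ideals generated in degrees `≥ 2` which are Yetter–Drinfeld submodules and coideals. -/
def nicholsIdeal : Ideal (TensorAlgebra k W) :=
  sSup {I | Y.IsNicholsRelationIdeal I}

/-- The projection `T(W) → T(W)/I`. -/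
def proj (I : Ideal (TensorAlgebra k W)) [I.IsTwoSided] :
    TensorAlgebra k W →ₐ[k] TensorAlgebra k W ⧸ I :=
  Ideal.Quotient.mkₐ k I

/-- A linear map on `T(W)` vanishing on `I`, as a linear map on `T(W)/I`. -/
def quotLift (I : Ideal (TensorAlgebra k W)) [I.IsTwoSided] {M : Type*} [AddCommGroup M]
    [Module k M] (g : TensorAlgebra k W →ₗ[k] M) (hg : ∀ x ∈ I, g x = 0) :
    TensorAlgebra k W ⧸ I →ₗ[k] M :=
  (I.restrictScalars k).liftQ g hg ∘ₗ
    (Submodule.Quotient.restrictScalarsEquiv k I).symm.toLinearMap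

theorem quotLift_proj (I : Ideal (TensorAlgebra k W)) [I.IsTwoSided] {M : Type*} [AddCommGroup M]
    [Module k M] (g : TensorAlgebra k W →ₗ[k] M) (hg : ∀ x ∈ I, g x = 0)
    (x : TensorAlgebra k W) : quotLift I g hg (proj I x) = g x := rfl

theorem proj_eq_zero (I : Ideal (TensorAlgebra k W)) [I.IsTwoSided] {x : TensorAlgebra k W}
    (hx : x ∈ I) : proj I x = 0 :=
  Ideal.Quotient.eq_zero_iff_mem.mpr hx

/-- The action of `H` on `T(W)/I` induced by the action on `T(W)`. -/
def quotAct (I : Ideal (TensorAlgebra k W)) [I.IsTwoSided] (hI : Y.IsActStable I) :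
    H →ₗ[k] Module.End k (TensorAlgebra k W ⧸ I) :=
  LinearMap.flip <| quotLift I ((Y.tensorAct.compr₂ₛₗ (proj I).toLinearMap).flip) fun x hx => by
    ext h; exact proj_eq_zero I (hI h x hx)

/-- The coaction of `H` on `T(W)/I` induced by the coaction on `T(W)`. -/
def quotCoact (I : Ideal (TensorAlgebra k W)) [I.IsTwoSided] (hI : Y.IsCoactStable I) :
    TensorAlgebra k W ⧸ I →ₗ[k] H ⊗[k] (TensorAlgebra k W ⧸ I) :=
  quotLift I ((proj I).toLinearMap.lTensor H ∘ₗ Y.tensorCoact) fun x hx => by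
    obtain ⟨t, ht⟩ := hI x hx
    rw [LinearMap.comp_apply, ← ht, ← LinearMap.comp_apply, ← LinearMap.lTensor_comp,
      show (proj I).toLinearMap ∘ₗ (I.restrictScalars k).subtype = 0 from
        LinearMap.ext fun y => proj_eq_zero I y.2, LinearMap.lTensor_zero, LinearMap.zero_apply]

/-- The comultiplication of `T(W)/I` induced by the comultiplication of `T(W)`. -/
def quotComul (I : Ideal (TensorAlgebra k W)) [I.IsTwoSided] (hI : Y.IsComulStable I) :
    TensorAlgebra k W ⧸ I →ₗ[k] (TensorAlgebra k W ⧸ I) ⊗[k] (TensorAlgebra k W ⧸ I) :=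
  quotLift I (TensorProduct.map (proj I).toLinearMap (proj I).toLinearMap ∘ₗ Y.tensorComul)
    fun x hx => by
      have h0 : (proj I).toLinearMap ∘ₗ (I.restrictScalars k).subtype = 0 :=
        LinearMap.ext fun y => proj_eq_zero I y.2
      obtain ⟨_, ⟨s, rfl⟩, _, ⟨t, rfl⟩, hst⟩ := Submodule.mem_sup.mp (hI x hx)
      rw [LinearMap.comp_apply, ← hst, map_add, ← LinearMap.comp_apply, ← LinearMap.comp_apply,
        LinearMap.rTensor, LinearMap.lTensor, ← TensorProduct.map_comp, ← TensorProduct.map_comp,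
        h0, TensorProduct.map_zero_left, TensorProduct.map_zero_right, LinearMap.zero_apply,
        LinearMap.zero_apply, add_zero]

/-! ### `𝔍(W)` is a two-sided ideal to which the structure of `T(W)` descends -/

theorem nicholsIdeal_induction {p : TensorAlgebra k W → Prop} (h0 : p 0)
    (hadd : ∀ x y, p x → p y → p (x + y))
    (hmem : ∀ I, Y.IsNicholsRelationIdeal I → I ≤ Y.nicholsIdeal → ∀ x ∈ I, p x)
    {x : TensorAlgebra k W} (hx : x ∈ Y.nicholsIdeal) : p x := by
  rw [nicholsIdeal, sSup_eq_iSup'] at hx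
  refine Submodule.iSup_induction _ (motive := p) hx (fun I y hy => ?_) h0 hadd
  exact hmem I.1 I.2 (le_sSup I.2) y hy

instance nicholsIdeal_isTwoSided : Y.nicholsIdeal.IsTwoSided where
  mul_mem_of_left {a} b ha := by
    refine Y.nicholsIdeal_induction (p := fun a => a * b ∈ Y.nicholsIdeal) ?_ ?_ ?_ ha
    · simp
    · intro x y hx hy; rw [add_mul]; exact add_mem hx hy
    · intro I hI hle x hx
      have := hI.isTwoSided
      exact hle (I.mul_mem_right b hx)

theorem nicholsIdeal_act : Y.IsActStable Y.nicholsIdeal := fun h x hx => by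
  refine Y.nicholsIdeal_induction (p := fun x => Y.tensorAct h x ∈ Y.nicholsIdeal) ?_ ?_ ?_ hx
  · simp
  · intro x y hx hy; rw [map_add]; exact add_mem hx hy
  · intro I hI hle x hx; exact hle (hI.act_mem h x hx)

theorem nicholsIdeal_coact : Y.IsCoactStable Y.nicholsIdeal := fun x hx => by
  refine Y.nicholsIdeal_induction (p := fun x => Y.tensorCoact x ∈
    LinearMap.range ((Y.nicholsIdeal.restrictScalars k).subtype.lTensor H)) ?_ ?_ ?_ hx
  · simp
  · intro x y hx hy; rw [map_add]; exact add_mem hx hy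
  · intro I hI hle x hx
    obtain ⟨t, ht⟩ := hI.coact_mem x hx
    refine ⟨(Submodule.inclusion (p := I.restrictScalars k)
      (p' := Y.nicholsIdeal.restrictScalars k) hle).lTensor H t, ?_⟩
    rw [← ht, ← LinearMap.comp_apply, ← LinearMap.lTensor_comp]
    rfl

theorem nicholsIdeal_comul : Y.IsComulStable Y.nicholsIdeal := fun x hx => by
  refine Y.nicholsIdeal_induction (p := fun x => Y.tensorComul x ∈
    LinearMap.range ((Y.nicholsIdeal.restrictScalars k).subtype.rTensor (TensorAlgebra k W)) ⊔
    LinearMap.range ((Y.nicholsIdeal.restrictScalars k).subtype.lTensor (TensorAlgebra k W)))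
    ?_ ?_ ?_ hx
  · simp
  · intro x y hx hy; rw [map_add]; exact add_mem hx hy
  · intro I hI hle x hx
    refine SetLike.le_def.mp (sup_le_sup ?_ ?_) (hI.comul_mem x hx)
    · rintro _ ⟨t, rfl⟩
      refine ⟨(Submodule.inclusion (p := I.restrictScalars k)
        (p' := Y.nicholsIdeal.restrictScalars k) hle).rTensor _ t, ?_⟩
      rw [← LinearMap.comp_apply, ← LinearMap.rTensor_comp]
      rfl
    · rintro _ ⟨t, rfl⟩
      refine ⟨(Submodule.inclusion (p := I.restrictScalars k)
        (p' := Y.nicholsIdeal.restrictScalars k) hle).lTensor _ t, ?_⟩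
      rw [← LinearMap.comp_apply, ← LinearMap.lTensor_comp]
      rfl

theorem nicholsIdeal_degree_one : ∀ x ∈ Y.nicholsIdeal,
    (TensorAlgebra.ιInv : TensorAlgebra k W →ₗ[k] W) x = 0 := fun x hx => by
  refine Y.nicholsIdeal_induction
    (p := fun x => (TensorAlgebra.ιInv : TensorAlgebra k W →ₗ[k] W) x = 0) ?_ ?_ ?_ hx
  · simp
  · intro x y hx hy; rw [map_add, hx, hy, add_zero]
  · intro I hI _ x hx; exact hI.degree_one x hx

/-! ### The Nichols algebra and its canonical braided derivations -/

/-- The Nichols algebra `𝓑(W) = T(W)/𝔍(W)`. -/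
abbrev NicholsAlgebra : Type (max u w) := TensorAlgebra k W ⧸ Y.nicholsIdeal

/-- The projection of `𝓑(W)` to its homogeneous component `𝓑¹(W) = W`. -/
def nicholsPrOne : Y.NicholsAlgebra →ₗ[k] W :=
  quotLift Y.nicholsIdeal TensorAlgebra.ιInv Y.nicholsIdeal_degree_one

/-- The canonical braided derivation of `𝓑(W)` given by `f ∈ W^*`, that is
`x ↦ ⟨f, x^[1]⟩ x^[2]` where `x^[1] ⊗ x^[2] = c⁻¹(Δ(x))` and `f` is extended by zero to `𝓑(W)`
along the projection to `𝓑¹(W) = W`. -/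
def nicholsDeriv (hS : Function.Bijective (HopfAlgebra.antipode k (A := H)))
    (f : Module.Dual k W) : Module.End k Y.NicholsAlgebra :=
  quantumDiff hS (Y.quotAct Y.nicholsIdeal Y.nicholsIdeal_act)
    (Y.quotCoact Y.nicholsIdeal Y.nicholsIdeal_coact)
    (Y.quotComul Y.nicholsIdeal Y.nicholsIdeal_comul) (f ∘ₗ Y.nicholsPrOne)

/-- The endomorphisms `d f` (`f ∈ W^*`) of `R = T(W)/I` satisfy the braided Leibniz rule
`d_f(x y) = (f₍₋₁₎ · x) d_{f₍₀₎}(y) + d_f(x) y` and `d_f(π(v)) = ⟨f, v⟩`. The rule is required for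
every expression `∑ᵢ hᵢ ⊗ gᵢ` of the coaction `f₍₋₁₎ ⊗ f₍₀₎` of `f` as a finite sum of pure
tensors; linearity of `f ↦ d f` is not imposed separately. -/
structure IsBraidedDerivationFamily [FiniteDimensional k W]
    (hS : Function.Bijective (HopfAlgebra.antipode k (A := H)))
    (I : Ideal (TensorAlgebra k W)) [I.IsTwoSided] (hI : Y.IsActStable I)
    (d : Module.Dual k W → Module.End k (TensorAlgebra k W ⧸ I)) : Prop where
  leibniz : ∀ (f : Module.Dual k W) (n : ℕ) (h : Fin n → H) (g : Fin n → Module.Dual k W),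
    Y.dualCoact hS f = ∑ i, h i ⊗ₜ[k] g i →
    ∀ x y, d f (x * y) = ∑ i, Y.quotAct I hI (h i) x * d (g i) y + d f x * y
  apply_proj : ∀ (f : Module.Dual k W) (v : W),
    d f (proj I (TensorAlgebra.ι k v)) = algebraMap k _ (f v)

end Ideals

end YetterDrinfeld

end YD

end

/-! Fix a basis `b` of `W` and write the coaction as `b j ↦ ∑ i, c j i ⊗ b i`. Two families of
operators on `T(W)` are compared. The skew derivations `∂_i = (id ⊗ b^i) Δ` see the comultiplication
directly and satisfy `∂_i(xy) = x ∂_i(y) + ∑ j, ∂_j(x) (c j i · y)` (`skewDeriv_mul`). The braided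
derivations `D_i = ∑ j, S⁻¹(c j i) · ∂_j` are those obtained from `c⁻¹ Δ`
(`quantumDiff_tensorComul`). The matrices `c` and `S⁻¹(c)` are inverse to each other in a suitable
order of factors, so the twist on `y` cancels and `D` satisfies the Leibniz rule (∗)
(`braidedDeriv_mul`), while `∂` is recovered from `D` by `∂_m = ∑ i, c i m · D_i`
(`skewDeriv_eq_sum_braidedDeriv`). For an `H`-stable ideal, stability under all `D_i` therefore
amounts to stability under all `∂_i`.

(i) A homogeneous ideal `I` with `I ∩ W = 0` has no linear part. If it is also a coideal, applying
`id ⊗ b^i` to `I ⊗ T(W) + T(W) ⊗ I` lands in `I`. Hence all `∂_i`, and then all `D_i`, preserve `I`,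
and the `D_i` descend to `R`.

(ii) A family `d` on `R` is forced: the Leibniz rule and the values on generators give `d_i π = π
D_i` (`apply_coord_proj`). Since `d_i` is defined on `R`, each `D_i`, hence each `∂_i`, preserves
`I`. So `I` lies in the largest subspace `K` of `T(W)⁺` stable under the `∂_i` (`skewKernel`). By
maximality `K` is itself a homogeneous two-sided ideal, a Yetter–Drinfeld submodule and a coideal
without linear part (`isNicholsRelationIdeal_skewIdeal`), so `I ⊆ K ⊆ 𝔍(W)`. Finally `Ω` is the
induced quotient map, and it intertwines the derivations because both sides are induced by the same
operators `D_i`. -/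

noncomputable section

namespace YD

universe u v w

/-! ### Sweedler calculus for the comultiplication of `H`. -/

section Sweedler

variable {k : Type u} {H : Type v} [Field k] [Ring H] [HopfAlgebra k H]
variable {M N : Type*} [AddCommGroup M] [Module k M] [AddCommGroup N] [Module k N]

/-- The Sweedler sum `G(h₍₁₎, h₍₂₎)`, for a fixed expression of the comultiplication of `h`. -/
def sweedler (k : Type u) {H : Type v} [Field k] [Ring H] [HopfAlgebra k H] {M : Type*}
    [AddCommGroup M] (h : H) (G : H → H → M) : M :=
  ∑ i ∈ (Coalgebra.Repr.arbitrary k h).index,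
    G ((Coalgebra.Repr.arbitrary k h).left i) ((Coalgebra.Repr.arbitrary k h).right i)

variable (k) in
/-- `G` is linear in each of its two arguments. -/
structure IsBilin {H : Type v} [AddCommMonoid H] [Module k H] (G : H → H → M) : Prop where
  left : ∀ c, IsLinearMap k (fun a => G a c)
  right : ∀ a, IsLinearMap k (fun c => G a c)

variable (k) in
/-- `F` is linear in each of its three arguments. -/
structure IsTrilin {H : Type v} [AddCommMonoid H] [Module k H] (F : H → H → H → M) : Prop where
  fst : ∀ b c, IsLinearMap k (fun a => F a b c)
  snd : ∀ a c, IsLinearMap k (fun b => F a b c)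
  thd : ∀ a b, IsLinearMap k (fun c => F a b c)

/-- A bilinear function as a linear map on the tensor square. -/
def IsBilin.toLin {G : H → H → M} (hG : IsBilin k G) : H ⊗[k] H →ₗ[k] M :=
  TensorProduct.lift (LinearMap.mk₂ k G (fun a a' c => (hG.left c).map_add a a')
    (fun r a c => (hG.left c).map_smul r a) (fun a c c' => (hG.right a).map_add c c')
    (fun r a c => (hG.right a).map_smul r c))

theorem IsBilin.toLin_tmul {G : H → H → M} (hG : IsBilin k G) (a c : H) :
    hG.toLin (a ⊗ₜ c) = G a c := rfl

/-- Bilinearity makes the sum independent of the chosen expression of `Δ(h)`, so any other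
expression may be substituted. -/
theorem IsBilin.sweedler_eq {G : H → H → M} (hG : IsBilin k G) (h : H) :
    sweedler k h G = hG.toLin (Coalgebra.comul h) := by
  rw [← (Coalgebra.Repr.arbitrary k h).eq, map_sum]; rfl

theorem map_sweedler (f : M →ₗ[k] N) (h : H) (G : H → H → M) :
    f (sweedler k h G) = sweedler k h fun a c => f (G a c) := by
  simp [sweedler]

omit [Module k M] in
theorem sweedler_congr {h : H} {G G' : H → H → M} (hG : ∀ a c, G a c = G' a c) :
    sweedler k h G = sweedler k h G' := by
  simp [sweedler, hG]

omit [Module k M] in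
theorem sweedler_add (h : H) (G G' : H → H → M) :
    (sweedler k h fun a c => G a c + G' a c) = sweedler k h G + sweedler k h G' :=
  Finset.sum_add_distrib

theorem comul_eq_sweedler (h : H) :
    Coalgebra.comul (R := k) h = sweedler k h fun a c => a ⊗ₜ[k] c :=
  (Coalgebra.Repr.arbitrary k h).eq.symm

/-- A trilinear function as a linear map on the tensor cube. -/
def IsTrilin.toLin {F : H → H → H → M} (hF : IsTrilin k F) : (H ⊗[k] (H ⊗[k] H)) →ₗ[k] M :=
  TensorProduct.lift (TensorProduct.lift.equiv (.id k) H H M ∘ₗ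
    LinearMap.mk₂ k (fun a b => (hF.thd a b).mk' _)
      (fun a a' b => LinearMap.ext fun c => (hF.fst b c).map_add a a')
      (fun r a b => LinearMap.ext fun c => (hF.fst b c).map_smul r a)
      (fun a b b' => LinearMap.ext fun c => (hF.snd a c).map_add b b')
      (fun r a b => LinearMap.ext fun c => (hF.snd a c).map_smul r b))

theorem IsTrilin.toLin_tmul {F : H → H → H → M} (hF : IsTrilin k F) (a b c : H) :
    hF.toLin (a ⊗ₜ (b ⊗ₜ c)) = F a b c := rfl

/-- Coassociativity: `F(h₍₁₎₍₁₎, h₍₁₎₍₂₎, h₍₂₎) = F(h₍₁₎, h₍₂₎₍₁₎, h₍₂₎₍₂₎)`. -/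
theorem IsTrilin.sweedler_assoc {F : H → H → H → M} (hF : IsTrilin k F) (h : H) :
    (sweedler k h fun a c => sweedler k a fun a₁ a₂ => F a₁ a₂ c) =
      sweedler k h fun a c => sweedler k c fun c₁ c₂ => F a c₁ c₂ := by
  have := congrArg hF.toLin (Coalgebra.coassoc_apply (R := k) h)
  rw [comul_eq_sweedler h] at this
  simp only [map_sweedler, LinearMap.rTensor_tmul, LinearMap.lTensor_tmul, comul_eq_sweedler]
    at this
  have e1 : ∀ a c : H, (sweedler k a fun a₁ a₂ => F a₁ a₂ c) = hF.toLin
      (TensorProduct.assoc k H H H ((sweedler k a fun a₁ a₂ => a₁ ⊗ₜ[k] a₂) ⊗ₜ[k] c)) := by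
    intro a c
    simp only [sweedler, TensorProduct.sum_tmul, map_sum, TensorProduct.assoc_tmul, hF.toLin_tmul]
  have e2 : ∀ a c : H, (sweedler k c fun c₁ c₂ => F a c₁ c₂) = hF.toLin
      (a ⊗ₜ[k] (sweedler k c fun c₁ c₂ => c₁ ⊗ₜ[k] c₂)) := by
    intro a c
    simp only [sweedler, TensorProduct.tmul_sum, map_sum, hF.toLin_tmul]
  simp only [e1, e2]
  simpa only [sweedler, map_sum] using this

theorem sweedler_counit_left {f : H → M} (hf : IsLinearMap k f) (h : H) :
    (sweedler k h fun a c => Coalgebra.counit (R := k) a • f c) = f h := by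
  have := congrArg (hf.mk' f) (Coalgebra.sum_counit_smul (R := k) (Coalgebra.Repr.arbitrary k h))
  simpa [sweedler] using this

theorem sweedler_mul {G : H → H → M} (hG : IsBilin k G) (g h : H) :
    sweedler k (g * h) G =
      sweedler k g fun a c => sweedler k h fun a' c' => G (a * a') (c * c') := by
  rw [hG.sweedler_eq, Bialgebra.comul_mul, comul_eq_sweedler g, comul_eq_sweedler h]
  simp only [sweedler, Finset.sum_mul_sum, map_sum, Algebra.TensorProduct.tmul_mul_tmul,
    hG.toLin_tmul]

theorem sweedler_antipode_left {f : H → M} (hf : IsLinearMap k f) (h : H) :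
    (sweedler k h fun a c => f (HopfAlgebra.antipode k a * c)) =
      Coalgebra.counit (R := k) h • f 1 := by
  have := congrArg (hf.mk' f)
    (HopfAlgebra.sum_antipode_mul_eq_smul (R := k) (Coalgebra.Repr.arbitrary k h))
  simpa [sweedler] using this

theorem sweedler_smul (h : H) (r : k) (G : H → H → M) :
    (sweedler k h fun a c => r • G a c) = r • sweedler k h G :=
  Finset.smul_sum.symm

end Sweedler

section Sweedler

variable {k : Type u} {H : Type v} [Field k] [Ring H] [HopfAlgebra k H]
variable {M N : Type*} [AddCommGroup M] [Module k M] [AddCommGroup N] [Module k N]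

theorem sweedler_counit_right {f : H → M} (hf : IsLinearMap k f) (h : H) :
    (sweedler k h fun a c => Coalgebra.counit (R := k) c • f a) = f h := by
  have := congrArg ((hf.mk' f) ∘ₗ (TensorProduct.rid k H).toLinearMap)
    (Coalgebra.sum_tmul_counit_eq (R := k) (Coalgebra.Repr.arbitrary k h))
  simp only [map_sum, LinearMap.comp_apply, LinearEquiv.coe_coe, TensorProduct.rid_tmul, map_smul,
    one_smul] at this
  exact this

theorem IsBilin.isLinearMap_sweedler {G : H → H → M} (hG : IsBilin k G) :
    IsLinearMap k fun h => sweedler k h G := by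
  simp only [hG.sweedler_eq]
  exact (hG.toLin ∘ₗ Coalgebra.comul).isLinear

theorem mul_sweedler {A : Type*} [Ring A] (x : A) (h : H) (G : H → H → A) :
    x * sweedler k h G = sweedler k h fun a c => x * G a c := Finset.mul_sum _ _ _

theorem sweedler_mul_right {A : Type*} [Ring A] (x : A) (h : H) (G : H → H → A) :
    sweedler k h G * x = sweedler k h fun a c => G a c * x := Finset.sum_mul _ _ _

theorem tmul_sweedler (x : N) (h : H) (G : H → H → M) :
    x ⊗ₜ[k] sweedler k h G = sweedler k h fun a c => x ⊗ₜ[k] G a c := TensorProduct.tmul_sum _ _ _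

theorem sweedler_tmul (x : N) (h : H) (G : H → H → M) :
    sweedler k h G ⊗ₜ[k] x = sweedler k h fun a c => G a c ⊗ₜ[k] x := TensorProduct.sum_tmul _ _ _

end Sweedler

/-! ### Induction on the tensor algebra. -/

section TensorAlg

variable {k : Type u} {W : Type w} [Field k] [AddCommGroup W] [Module k W]

/-- Action, coaction and comultiplication are easiest to compute on a product whose left factor is a
generator. The proof strengthens the claim to: left multiplication by `x` preserves `p`. -/
theorem tensorAlgebra_left_induction {p : TensorAlgebra k W → Prop} (one : p 1)
    (smul : ∀ (r : k) x, p x → p (r • x)) (add : ∀ x y, p x → p y → p (x + y))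
    (ι_mul : ∀ w x, p x → p (TensorAlgebra.ι k w * x)) (x : TensorAlgebra k W) : p x := by
  suffices h : ∀ y, p y → p (x * y) by simpa using h 1 one
  induction x using TensorAlgebra.induction with
  | algebraMap r => intro y hy; rw [← Algebra.smul_def]; exact smul r y hy
  | ι w => exact ι_mul w
  | mul a b ha hb => intro y hy; rw [mul_assoc]; exact ha _ (hb _ hy)
  | add a b ha hb => intro y hy; rw [add_mul]; exact add _ _ (ha _ hy) (hb _ hy)

end TensorAlg

namespace YetterDrinfeld

variable {k : Type u} {H : Type v} {W : Type w} [Field k] [Ring H] [HopfAlgebra k H]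
  [AddCommGroup W] [Module k W] (Y : YetterDrinfeld k H W)

/-! ### The action on `T(W)` -/

theorem tensorAct_one_right (h : H) : Y.tensorAct h 1 = Coalgebra.counit (R := k) h • 1 := by
  simp [tensorAct, LinearMap.flip_apply, Algebra.algebraMap_eq_smul_one]

theorem tensorAct_ι (h : H) (w : W) :
    Y.tensorAct h (TensorAlgebra.ι k w) = TensorAlgebra.ι k (Y.act h w) := by
  simp [tensorAct, LinearMap.flip_apply]

theorem tensorAct_mul (h : H) (x y : TensorAlgebra k W) :
    Y.tensorAct h (x * y) = sweedler k h fun a c => Y.tensorAct a x * Y.tensorAct c y := by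
  simp only [tensorAct, LinearMap.flip_apply, LinearMap.comp_apply, AlgHom.toLinearMap_apply,
    map_mul]
  exact (Coalgebra.Repr.arbitrary k h).convMul_apply _ _

theorem tensorAct_one (x : TensorAlgebra k W) : Y.tensorAct 1 x = x := by
  induction x using tensorAlgebra_left_induction with
  | one => simp [tensorAct_one_right]
  | smul r x hx => rw [map_smul, hx]
  | add x y hx hy => rw [map_add, hx, hy]
  | ι_mul w x hx =>
    have hb : IsBilin k fun a c : H =>
        Y.tensorAct a (TensorAlgebra.ι k w) * Y.tensorAct c x := by
      constructor <;> intro <;> constructor <;> intros <;> simp [add_mul, mul_add]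
    rw [tensorAct_mul, hb.sweedler_eq, Bialgebra.comul_one, Algebra.TensorProduct.one_def,
      hb.toLin_tmul, hx, tensorAct_ι, map_one, Module.End.one_apply]

theorem tensorAct_mul_left (g h : H) (x : TensorAlgebra k W) :
    Y.tensorAct (g * h) x = Y.tensorAct g (Y.tensorAct h x) := by
  induction x using tensorAlgebra_left_induction generalizing g h with
  | one =>
    simp only [tensorAct_one_right, map_smul, Bialgebra.counit_mul, mul_smul]
    exact smul_comm _ _ _
  | smul r x hx => simp only [map_smul, hx]
  | add x y hx hy => simp only [map_add, hx, hy]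
  | ι_mul w x hx =>
    have hb : IsBilin k fun a c : H =>
        Y.tensorAct a (TensorAlgebra.ι k w) * Y.tensorAct c x := by
      constructor <;> intro <;> constructor <;> intros <;> simp [add_mul, mul_add]
    rw [tensorAct_mul, tensorAct_mul, sweedler_mul hb, map_sweedler]
    simp only [sweedler, tensorAct_mul, hx, tensorAct_ι, map_mul, Module.End.mul_apply]
    rw [Finset.sum_comm]

/-! ### The coaction on `T(W)` -/

theorem tensorCoact_one : Y.tensorCoact 1 = 1 ⊗ₜ 1 := by
  simp [tensorCoact, Algebra.TensorProduct.one_def]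

theorem tensorCoact_ι (w : W) : Y.tensorCoact (TensorAlgebra.ι k w) =
    (TensorAlgebra.ι k).lTensor H (Y.coact w) := by
  simp [tensorCoact]

theorem tensorCoact_mul (x y : TensorAlgebra k W) :
    Y.tensorCoact (x * y) = Y.tensorCoact x * Y.tensorCoact y := by
  simp [tensorCoact]

/-! ### The Yetter–Drinfeld condition -/

/-- The Yetter–Drinfeld condition for `W`:
`(h₍₁₎ · w)₍₋₁₎ h₍₂₎ ⊗ (h₍₁₎ · w)₍₀₎ = h₍₁₎ w₍₋₁₎ ⊗ h₍₂₎ · w₍₀₎`. -/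
theorem sweedler_coact_act (h : H) (w : W) :
    (sweedler k h fun a c => (LinearMap.mulRight k c).rTensor W (Y.coact (Y.act a w))) =
      sweedler k h fun a c => TensorProduct.map (LinearMap.mulLeft k a) (Y.act c) (Y.coact w) := by
  simp only [Y.coact_act]
  generalize Y.coact w = z
  induction z using TensorProduct.induction_on with
  | zero => simp [sweedler]
  | add x y hx hy => simp only [map_add, sweedler_add, hx, hy]
  | tmul g v =>
    have e : ∀ a c : H, (LinearMap.mulRight k c).rTensor W (conjAct Y.act.toLinearMap
        ((Coalgebra.comul (R := k)).lTensor H (Coalgebra.comul (R := k) a)) (g ⊗ₜ v)) =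
        sweedler k a fun a₁ a₂ => sweedler k a₂ fun p q =>
          (a₁ * g * HopfAlgebra.antipode k q * c) ⊗ₜ[k] Y.act p v := by
      intro a c
      let L : H ⊗[k] (H ⊗[k] H) →ₗ[k] H ⊗[k] W := (LinearMap.mulRight k c).rTensor W ∘ₗ
        LinearMap.applyₗ (g ⊗ₜ[k] v) ∘ₗ conjAct Y.act.toLinearMap
      have hL : ∀ a₁ p q, L (a₁ ⊗ₜ (p ⊗ₜ q)) =
          (a₁ * g * HopfAlgebra.antipode k q * c) ⊗ₜ[k] Y.act p v := fun a₁ p q =>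
        congrArg ((LinearMap.mulRight k c).rTensor W) (conjAct_tmul Y.act.toLinearMap a₁ p q g v)
      change L _ = _
      rw [comul_eq_sweedler a]
      simp only [map_sweedler, LinearMap.lTensor_tmul, comul_eq_sweedler, tmul_sweedler, hL]
    have b1 : ∀ a c : H, IsBilin k fun p q : H =>
          (a * g * HopfAlgebra.antipode k q * c) ⊗ₜ[k] Y.act p v := by
      intro a c
      constructor <;> intro <;> constructor <;> intros <;>
        simp [add_mul, mul_add, TensorProduct.add_tmul, TensorProduct.tmul_add,
          TensorProduct.smul_tmul']
    have t1 : IsTrilin k fun a b c : H => sweedler k b fun p q =>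
          (a * g * HopfAlgebra.antipode k q * c) ⊗ₜ[k] Y.act p v := by
      constructor
      · intro b c
        constructor <;> intros <;>
          simp [add_mul, TensorProduct.add_tmul, ← TensorProduct.smul_tmul', sweedler_add,
            sweedler_smul]
      · intro a c; exact (b1 a c).isLinearMap_sweedler
      · intro b c
        constructor <;> intros <;>
          simp [mul_add, TensorProduct.add_tmul, ← TensorProduct.smul_tmul', sweedler_add,
            sweedler_smul]
    -- The left side is `h₍₁₎ g S(h₍₃₎) h₍₄₎ ⊗ h₍₂₎ · v`. Two uses of coassociativity group the last
    -- two components, and `S(h₍₃₎) h₍₄₎` collapses to the counit.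
    simp only [e]
    rw [t1.sweedler_assoc]
    refine sweedler_congr fun a c => ?_
    have t2 : IsTrilin k fun p q c : H =>
        (a * g * HopfAlgebra.antipode k q * c) ⊗ₜ[k] Y.act p v := by
      constructor <;> intros <;> constructor <;> intros <;>
        simp [add_mul, mul_add, TensorProduct.add_tmul, TensorProduct.tmul_add,
          TensorProduct.smul_tmul']
    rw [t2.sweedler_assoc]
    have e2 : ∀ p r : H, (sweedler k r fun q c =>
        (a * g * HopfAlgebra.antipode k q * c) ⊗ₜ[k] Y.act p v) =
        Coalgebra.counit (R := k) r • ((a * g) ⊗ₜ[k] Y.act p v) := by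
      intro p r
      have := sweedler_antipode_left (k := k) (f := fun x : H => (a * g * x) ⊗ₜ[k] Y.act p v)
        (by constructor <;> intros <;> simp [mul_add, TensorProduct.add_tmul,
              TensorProduct.smul_tmul']) r
      simpa [mul_assoc] using this
    simp only [e2]
    rw [sweedler_counit_right (f := fun p : H => (a * g) ⊗ₜ[k] Y.act p v)
      (by constructor <;> intros <;> simp [TensorProduct.tmul_add])]
    simp

/-- The antipode-free form of the Yetter–Drinfeld condition passes through products, unlike a form
with `S(h₍₃₎)`, which would need cancellations at each factor. This is the generator case used in
the inductions below. -/
theorem sweedler_tensorCoact_act_ι (h : H) (w : W) :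
    (sweedler k h fun a c =>
      Y.tensorCoact (Y.tensorAct a (TensorAlgebra.ι k w)) * (c ⊗ₜ[k] 1)) =
      sweedler k h fun a c => TensorProduct.map (LinearMap.mulLeft k a) (Y.tensorAct c)
        (Y.tensorCoact (TensorAlgebra.ι k w)) := by
  have := congrArg ((TensorAlgebra.ι k).lTensor H) (Y.sweedler_coact_act h w)
  simp only [map_sweedler] at this
  convert this using 4 with a c a c
  · rw [tensorAct_ι, tensorCoact_ι]
    generalize Y.coact (Y.act a w) = z
    induction z using TensorProduct.induction_on with
    | zero => simp
    | add x y hx hy => simp only [map_add, add_mul, hx, hy]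
    | tmul g v => simp
  · rw [tensorCoact_ι]
    generalize Y.coact w = z
    induction z using TensorProduct.induction_on with
    | zero => simp
    | add x y hx hy => simp only [map_add, hx, hy]
    | tmul g v => simp [tensorAct_ι]

/-- The Yetter–Drinfeld condition for `T(W)`:
`(h₍₁₎ · y)₍₋₁₎ h₍₂₎ ⊗ (h₍₁₎ · y)₍₀₎ = h₍₁₎ y₍₋₁₎ ⊗ h₍₂₎ · y₍₀₎`. -/
theorem sweedler_tensorCoact_act (h : H) (y : TensorAlgebra k W) :
    (sweedler k h fun a c => Y.tensorCoact (Y.tensorAct a y) * (c ⊗ₜ[k] 1)) =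
      sweedler k h fun a c => TensorProduct.map (LinearMap.mulLeft k a) (Y.tensorAct c)
        (Y.tensorCoact y) := by
  induction y using tensorAlgebra_left_induction generalizing h with
  | one =>
    have h1 := sweedler_counit_left (k := k) (f := fun c : H => c ⊗ₜ[k] (1 : TensorAlgebra k W))
      (by constructor <;> intros <;> simp [TensorProduct.add_tmul, TensorProduct.smul_tmul']) h
    have h2 := sweedler_counit_right (k := k) (f := fun c : H => c ⊗ₜ[k] (1 : TensorAlgebra k W))
      (by constructor <;> intros <;> simp [TensorProduct.add_tmul, TensorProduct.smul_tmul']) h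
    simpa [tensorAct_one_right, tensorCoact_one] using h1.trans h2.symm
  | smul r x hx => simp only [map_smul, smul_mul_assoc, sweedler_smul, hx]
  | add x y hx hy => simp only [map_add, add_mul, sweedler_add, hx, hy]
  | ι_mul w y hy =>
    have t1 : IsTrilin k fun a b c : H => Y.tensorCoact (Y.tensorAct a (TensorAlgebra.ι k w)) *
        (Y.tensorCoact (Y.tensorAct b y) * (c ⊗ₜ[k] 1)) := by
      constructor <;> intros <;> constructor <;> intros <;>
        simp [add_mul, mul_add, TensorProduct.add_tmul, ← TensorProduct.smul_tmul']
    simp only [tensorAct_mul, map_sweedler, tensorCoact_mul, sweedler_mul_right, mul_assoc]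
    -- Coassociativity first groups the last two components at `y`, where the induction hypothesis
    -- applies. It then regroups the first two at `w`, where the generator case applies (`t2`), and
    -- `t3` restores the original grouping.
    rw [t1.sweedler_assoc]
    simp only [← mul_sweedler, hy]
    generalize Y.tensorCoact y = z
    induction z using TensorProduct.induction_on with
    | zero => simp [sweedler]
    | add x y hx hy => simp only [map_add, mul_add, sweedler_add, hx, hy]
    | tmul g x =>
      simp only [mul_sweedler, TensorProduct.map_tmul, LinearMap.mulLeft_apply]
      have t2 : IsTrilin k fun a b c : H => Y.tensorCoact (Y.tensorAct a (TensorAlgebra.ι k w)) *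
          ((b * g) ⊗ₜ[k] Y.tensorAct c x) := by
        constructor <;> intros <;> constructor <;> intros <;>
          simp [add_mul, mul_add, TensorProduct.add_tmul, TensorProduct.tmul_add,
            ← TensorProduct.smul_tmul']
      rw [← t2.sweedler_assoc]
      have e : ∀ a c : H, (sweedler k a fun a₁ a₂ =>
          Y.tensorCoact (Y.tensorAct a₁ (TensorAlgebra.ι k w)) *
            ((a₂ * g) ⊗ₜ[k] Y.tensorAct c x)) =
          (sweedler k a fun a₁ a₂ =>
            Y.tensorCoact (Y.tensorAct a₁ (TensorAlgebra.ι k w)) * (a₂ ⊗ₜ[k] 1)) *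
              (g ⊗ₜ[k] Y.tensorAct c x) := by
        intro a c
        rw [sweedler_mul_right]
        simp [mul_assoc]
      simp only [e, sweedler_tensorCoact_act_ι]
      generalize Y.tensorCoact (TensorAlgebra.ι k w) = U
      induction U using TensorProduct.induction_on with
      | zero => simp [sweedler]
      | add x y hx hy => simp only [map_add, add_mul, sweedler_add, hx, hy]
      | tmul m u =>
        simp only [sweedler_mul_right, TensorProduct.map_tmul, LinearMap.mulLeft_apply,
          Algebra.TensorProduct.tmul_mul_tmul, tensorAct_mul, tmul_sweedler]
        have t3 : IsTrilin k fun a b c : H =>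
            (a * m * g) ⊗ₜ[k] (Y.tensorAct b u * Y.tensorAct c x) := by
          constructor <;> intros <;> constructor <;> intros <;>
            simp [add_mul, mul_add, TensorProduct.add_tmul, TensorProduct.tmul_add,
              ← TensorProduct.smul_tmul']
        rw [t3.sweedler_assoc]
        simp only [mul_assoc]

end YetterDrinfeld

namespace YetterDrinfeld

variable {k : Type u} {H : Type v} {W : Type w} [Field k] [Ring H] [HopfAlgebra k H]
  [AddCommGroup W] [Module k W] (Y : YetterDrinfeld k H W)

/-! ### The comultiplication of `T(W)` -/

/-- The operator `p ⊗ q ↦ m · p ⊗ u q` on `T(W) ⊗ T(W)`, linear in `m ⊗ u`. -/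
def actMul : H ⊗[k] TensorAlgebra k W →ₗ[k]
    Module.End k (TensorAlgebra k W ⊗[k] TensorAlgebra k W) :=
  TensorProduct.lift ((TensorProduct.mapBilinear (RingHom.id k) _ _ _ _).compl₁₂ Y.tensorAct
    (LinearMap.mul k (TensorAlgebra k W)))

theorem actMul_tmul (m : H) (u p q : TensorAlgebra k W) :
    Y.actMul (m ⊗ₜ u) (p ⊗ₜ q) = Y.tensorAct m p ⊗ₜ (u * q) := rfl

theorem braidedMul_tmul (a b : TensorAlgebra k W) :
    braidedMul Y.tensorAct Y.tensorCoact (a ⊗ₜ b) =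
      (LinearMap.mulLeft k a).rTensor _ ∘ₗ Y.actMul (Y.tensorCoact b) := rfl

theorem tensorComul_one : Y.tensorComul 1 = 1 ⊗ₜ 1 := by
  simp [tensorComul, LinearMap.flip_apply]

/-- The defining lift sends `w` to braided left multiplication by `w ⊗ 1 + 1 ⊗ w`. This recursion
and the value at `1` are all that later computations with `Δ` use. -/
theorem tensorComul_ι_mul (w : W) (y : TensorAlgebra k W) :
    Y.tensorComul (TensorAlgebra.ι k w * y) =
      (LinearMap.mulLeft k (TensorAlgebra.ι k w)).rTensor _ (Y.tensorComul y) +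
        Y.actMul (Y.tensorCoact (TensorAlgebra.ι k w)) (Y.tensorComul y) := by
  have h1 : (LinearMap.mulLeft k (1 : TensorAlgebra k W)) = LinearMap.id := by ext; simp
  have h2 : Y.actMul (1 ⊗ₜ 1) = LinearMap.id := by
    ext p q
    simp [actMul_tmul, tensorAct_one]
  simp only [tensorComul, LinearMap.flip_apply, AlgHom.toLinearMap_apply, map_mul,
    TensorAlgebra.lift_ι_apply, LinearMap.comp_apply, LinearMap.add_apply, map_add,
    Module.End.mul_apply, TensorProduct.mk_apply, braidedMul_tmul, tensorCoact_one, h1, h2,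
    LinearMap.id_apply, LinearMap.rTensor_id]

/-- Moves the action on the left tensor factor into the coaction factor, producing the shape to
which the Yetter–Drinfeld condition applies. -/
theorem actMul_act (U : H ⊗[k] TensorAlgebra k W) (c : H) (p q : TensorAlgebra k W) :
    Y.actMul U (Y.tensorAct c p ⊗ₜ q) = Y.actMul (U * (c ⊗ₜ 1)) (p ⊗ₜ q) := by
  induction U using TensorProduct.induction_on with
  | zero => simp
  | add x y hx hy => simp only [map_add, add_mul, LinearMap.add_apply, hx, hy]
  | tmul m u => simp [actMul_tmul, tensorAct_mul_left]

/-- The comultiplication of `T(W)` is `H`-linear. -/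
theorem tensorComul_act (h : H) (y : TensorAlgebra k W) :
    Y.tensorComul (Y.tensorAct h y) = sweedler k h fun a c =>
      TensorProduct.map (Y.tensorAct a) (Y.tensorAct c) (Y.tensorComul y) := by
  induction y using tensorAlgebra_left_induction generalizing h with
  | one =>
    have h1 := sweedler_counit_left (k := k) (f := fun c : H => Coalgebra.counit (R := k) c •
      ((1 : TensorAlgebra k W) ⊗ₜ[k] (1 : TensorAlgebra k W)))
      (by constructor <;> intros <;> simp [add_smul, mul_smul]) h
    simp only [tensorAct_one_right, map_smul, tensorComul_one, TensorProduct.map_tmul,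
      TensorProduct.tmul_smul, ← TensorProduct.smul_tmul']
    rw [← h1]
    exact sweedler_congr fun a c => smul_comm _ _ _
  | smul r x hx => simp only [map_smul, sweedler_smul, hx]
  | add x y hx hy => simp only [map_add, sweedler_add, hx, hy]
  | ι_mul w y hy =>
    simp only [tensorAct_mul, map_sweedler]
    simp only [tensorAct_ι, tensorComul_ι_mul, hy, map_add, sweedler_add]
    generalize Y.tensorComul y = Z
    congr 1
    · induction Z using TensorProduct.induction_on with
      | zero => simp [sweedler]
      | add x y hx hy => simp only [map_add, sweedler_add, hx, hy]
      | tmul p q =>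
        simp only [map_sweedler, TensorProduct.map_tmul, LinearMap.rTensor_tmul,
          LinearMap.mulLeft_apply, ← tensorAct_ι, tensorAct_mul, sweedler_tmul]
        have t : IsTrilin k fun a b c : H => (Y.tensorAct a (TensorAlgebra.ι k w) *
            Y.tensorAct b p) ⊗ₜ[k] Y.tensorAct c q := by
          constructor <;> intros <;> constructor <;> intros <;>
            simp [add_mul, mul_add, TensorProduct.add_tmul, TensorProduct.tmul_add,
              ← TensorProduct.smul_tmul']
        exact t.sweedler_assoc h |>.symm
    · induction Z using TensorProduct.induction_on with
      | zero => simp [sweedler]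
      | add x y hx hy => simp only [map_add, sweedler_add, hx, hy]
      | tmul p q =>
        simp only [map_sweedler, TensorProduct.map_tmul, ← tensorAct_ι, actMul_act]
        have t1 : IsTrilin k fun a b c : H =>
            Y.actMul (Y.tensorCoact (Y.tensorAct a (TensorAlgebra.ι k w)) * (b ⊗ₜ[k] 1))
              (p ⊗ₜ[k] Y.tensorAct c q) := by
          constructor <;> intros <;> constructor <;> intros <;>
            simp [add_mul, mul_add, TensorProduct.add_tmul, TensorProduct.tmul_add,
              ← TensorProduct.smul_tmul']
        -- Grouping the first two components around the generator makes the Yetter–Drinfeld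
        -- condition applicable. It moves `h₍₁₎` to the left of the coaction of `w`; the last
        -- regrouping is `t3`.
        rw [← t1.sweedler_assoc]
        have e : ∀ a c : H, (sweedler k a fun a b =>
            Y.actMul (Y.tensorCoact (Y.tensorAct a (TensorAlgebra.ι k w)) * (b ⊗ₜ[k] 1))
              (p ⊗ₜ[k] Y.tensorAct c q)) = Y.actMul (sweedler k a fun a b =>
              Y.tensorCoact (Y.tensorAct a (TensorAlgebra.ι k w)) * (b ⊗ₜ[k] 1))
              (p ⊗ₜ[k] Y.tensorAct c q) := by
          intro a c
          exact (map_sweedler (LinearMap.applyₗ (p ⊗ₜ[k] Y.tensorAct c q) ∘ₗ Y.actMul) a _).symm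
        simp only [e, sweedler_tensorCoact_act_ι]
        generalize Y.tensorCoact (TensorAlgebra.ι k w) = U
        induction U using TensorProduct.induction_on with
        | zero => simp [sweedler]
        | add x y hx hy => simp only [map_add, LinearMap.add_apply, sweedler_add, hx, hy]
        | tmul m u =>
          have e2 : ∀ a c : H, Y.actMul (sweedler k a fun a b =>
              TensorProduct.map (LinearMap.mulLeft k a) (Y.tensorAct b) (m ⊗ₜ[k] u))
              (p ⊗ₜ[k] Y.tensorAct c q) = sweedler k a fun a b =>
                Y.tensorAct a (Y.tensorAct m p) ⊗ₜ[k] (Y.tensorAct b u * Y.tensorAct c q) := by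
            intro a c
            refine (map_sweedler
              (LinearMap.applyₗ (p ⊗ₜ[k] Y.tensorAct c q) ∘ₗ Y.actMul) a _).trans
              (sweedler_congr fun a b => ?_)
            rw [← tensorAct_mul_left]; rfl
          simp only [e2]
          simp only [actMul_tmul, TensorProduct.map_tmul, tensorAct_mul, tmul_sweedler]
          have t3 : IsTrilin k fun a b c : H =>
              Y.tensorAct a (Y.tensorAct m p) ⊗ₜ[k] (Y.tensorAct b u * Y.tensorAct c q) := by
            constructor <;> intros <;> constructor <;> intros <;>
              simp [add_mul, mul_add, TensorProduct.add_tmul, TensorProduct.tmul_add,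
                ← TensorProduct.smul_tmul']
          exact t3.sweedler_assoc h

/-! ### Counits -/

theorem algebraMapInv_ι_mul (w : W) (y : TensorAlgebra k W) :
    TensorAlgebra.algebraMapInv (TensorAlgebra.ι k w * y) = 0 := by
  simp [TensorAlgebra.algebraMapInv]

theorem algebraMapInv_act (h : H) (y : TensorAlgebra k W) :
    TensorAlgebra.algebraMapInv (Y.tensorAct h y) =
      Coalgebra.counit (R := k) h * TensorAlgebra.algebraMapInv y := by
  induction y using tensorAlgebra_left_induction with
  | one => simp [tensorAct_one_right]
  | smul r x hx => simp [hx, mul_left_comm]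
  | add x y hx hy => simp [hx, hy, mul_add]
  | ι_mul w y hy =>
    rw [tensorAct_mul, ← AlgHom.toLinearMap_apply, map_sweedler]
    simp [tensorAct_ι, algebraMapInv_ι_mul, sweedler]

/-- `ιInv` is the second component of an algebra map to the trivial square-zero extension of `k` by
`W`, whose first component is the counit (`h`). -/
theorem ιInv_ι_mul (w : W) (y : TensorAlgebra k W) :
    TensorAlgebra.ιInv (TensorAlgebra.ι k w * y) =
      (TensorAlgebra.algebraMapInv y : k) • w := by
  have h : ∀ y : TensorAlgebra k W, TrivSqZeroExt.fst
      (letI := Module.compHom W ((RingHom.id k).fromOpposite mul_comm)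
       haveI : IsCentralScalar k W := ⟨fun r m => rfl⟩
       TensorAlgebra.toTrivSqZeroExt y) = (TensorAlgebra.algebraMapInv y : k) := by
    intro y
    let := Module.compHom W ((RingHom.id k).fromOpposite mul_comm)
    have : IsCentralScalar k W := ⟨fun r m => rfl⟩
    have : (TrivSqZeroExt.fstHom k k W).comp TensorAlgebra.toTrivSqZeroExt =
        (TensorAlgebra.algebraMapInv : TensorAlgebra k W →ₐ[k] k) := by
      ext w; simp [TensorAlgebra.algebraMapInv]
    exact DFunLike.congr_fun this y
  simp only [TensorAlgebra.ιInv, LinearMap.comp_apply, AlgHom.toLinearMap_apply, map_mul,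
    TensorAlgebra.toTrivSqZeroExt_ι, TrivSqZeroExt.sndHom_apply, TrivSqZeroExt.snd_mul, h]
  simp
  rfl

theorem ιInv_one : (TensorAlgebra.ιInv : TensorAlgebra k W →ₗ[k] W) 1 = 0 := by
  let := Module.compHom W ((RingHom.id k).fromOpposite mul_comm)
  have : IsCentralScalar k W := ⟨fun r m => rfl⟩
  exact congrArg TrivSqZeroExt.snd (map_one (TensorAlgebra.toTrivSqZeroExt (R := k) (M := W)))

/-- `(id ⊗ ε) Δ = id`. -/
theorem lTensor_algebraMapInv_tensorComul (y : TensorAlgebra k W) :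
    TensorProduct.rid k _
      ((TensorAlgebra.algebraMapInv : TensorAlgebra k W →ₐ[k] k).toLinearMap.lTensor _
        (Y.tensorComul y)) = y := by
  induction y using tensorAlgebra_left_induction with
  | one => simp [tensorComul_one]
  | smul r x hx => simp only [map_smul, hx]
  | add x y hx hy => simp only [map_add, hx, hy]
  | ι_mul w y hy =>
    rw [tensorComul_ι_mul]
    nth_rewrite 3 [← hy]
    generalize Y.tensorComul y = Z
    induction Z using TensorProduct.induction_on with
    | zero => simp
    | add x y hx hy => simp only [map_add, mul_add, ← hx, ← hy]; abel
    | tmul p q =>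
      rw [tensorCoact_ι]
      -- The braided term of the recursion has a generator on the left of its second tensor factor,
      -- so the counit kills it.
      have : ∀ z : H ⊗[k] W, (TensorProduct.rid k (TensorAlgebra k W))
          (((TensorAlgebra.algebraMapInv : TensorAlgebra k W →ₐ[k] k).toLinearMap.lTensor _)
            (Y.actMul ((TensorAlgebra.ι k).lTensor H z) (p ⊗ₜ q))) = 0 := by
        intro z
        induction z using TensorProduct.induction_on with
        | zero => simp
        | add x y hx hy => simp only [map_add, LinearMap.add_apply, hx, hy, add_zero]
        | tmul m u => simp [actMul_tmul, algebraMapInv_ι_mul]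
      rw [map_add, map_add, this]
      simp

end YetterDrinfeld

/-! ### Coordinates with respect to a basis of `W`. -/

theorem sum_coord_tmul {k : Type u} {M : Type v} {W : Type w} [Field k] [AddCommGroup M]
    [Module k M] [AddCommGroup W] [Module k W] {ι : Type*} [Fintype ι] (b : Module.Basis ι k W)
    (z : M ⊗[k] W) :
    ∑ i, TensorProduct.rid k M ((b.coord i).lTensor M z) ⊗ₜ[k] b i = z := by
  induction z using TensorProduct.induction_on with
  | zero => simp
  | add x y hx hy =>
    simp only [map_add, TensorProduct.add_tmul, Finset.sum_add_distrib, hx, hy]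
  | tmul m w =>
    simp only [LinearMap.lTensor_tmul, TensorProduct.rid_tmul, TensorProduct.smul_tmul,
      ← TensorProduct.tmul_sum, Module.Basis.coord_apply, b.sum_repr]

theorem tensorAlgebra_basis_induction {k : Type u} {W : Type w} [Field k] [AddCommGroup W]
    [Module k W] {ι : Type*} (b : Module.Basis ι k W) {p : TensorAlgebra k W → Prop}
    (one : p 1) (smul : ∀ (r : k) x, p x → p (r • x)) (add : ∀ x y, p x → p y → p (x + y))
    (ι_mul : ∀ j x, p x → p (TensorAlgebra.ι k (b j) * x)) (x : TensorAlgebra k W) : p x := by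
  induction x using tensorAlgebra_left_induction with
  | one => exact one
  | smul r x hx => exact smul r x hx
  | add x y hx hy => exact add x y hx hy
  | ι_mul w x hx =>
    induction b.mem_span w using Submodule.span_induction with
    | mem w hw => obtain ⟨j, rfl⟩ := hw; exact ι_mul j x hx
    | zero => simpa using smul 0 1 one
    | add v w _ _ hv hw => rw [map_add, add_mul]; exact add _ _ hv hw
    | smul r w _ hw => rw [map_smul, smul_mul_assoc]; exact smul _ _ hw

namespace YetterDrinfeld

variable {k : Type u} {H : Type v} {W : Type w} [Field k] [Ring H] [HopfAlgebra k H]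
  [AddCommGroup W] [Module k W] (Y : YetterDrinfeld k H W)
  {ι : Type*} [Fintype ι] (b : Module.Basis ι k W)

/-! ### Matrix coefficients of the coaction -/

/-- The matrix coefficients of the coaction of `W` in the basis `b`. -/
def coeff (j i : ι) : H := TensorProduct.rid k H ((b.coord i).lTensor H (Y.coact (b j)))

theorem coact_basis (j : ι) : Y.coact (b j) = ∑ i, Y.coeff b j i ⊗ₜ[k] b i :=
  (sum_coord_tmul b _).symm

/-- Coassociativity of the coaction, read off at the `i`-th coordinate. -/
theorem comul_coeff (j i : ι) :
    Coalgebra.comul (R := k) (Y.coeff b j i) = ∑ l, Y.coeff b j l ⊗ₜ[k] Y.coeff b l i := by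
  classical
  have h := congrArg (((TensorProduct.rid k H).toLinearMap ∘ₗ (b.coord i).lTensor H).lTensor H)
    (Y.coassoc_coact (b j))
  have e : ∀ (z : H ⊗[k] H) (l : ι), ((TensorProduct.rid k H).toLinearMap ∘ₗ
      (b.coord i).lTensor H).lTensor H (TensorProduct.assoc k H H W (z ⊗ₜ b l)) =
      b.coord i (b l) • z := by
    intro z l
    induction z using TensorProduct.induction_on with
    | zero => simp
    | add x y hx hy => simp only [TensorProduct.add_tmul, map_add, smul_add, hx, hy]
    | tmul g g' => simp [TensorProduct.smul_tmul']
  rw [coact_basis] at h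
  simp only [map_sum, LinearMap.rTensor_tmul, e, LinearMap.lTensor_tmul, coact_basis] at h
  simpa [Module.Basis.repr_self, Finsupp.single_apply, ite_smul, ← ite_zero_smul] using h

variable [DecidableEq ι]

theorem counit_coeff (j i : ι) :
    Coalgebra.counit (R := k) (Y.coeff b j i) = if j = i then 1 else 0 := by
  have h := congrArg (b.coord i) (Y.counit_coact (b j))
  rw [coact_basis] at h
  simpa [Finsupp.single_apply] using h

omit [DecidableEq ι] in
theorem sweedler_coeff {M : Type*} [AddCommGroup M] [Module k M] {G : H → H → M}
    (hG : IsBilin k G) (j i : ι) :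
    sweedler k (Y.coeff b j i) G = ∑ l, G (Y.coeff b j l) (Y.coeff b l i) := by
  rw [hG.sweedler_eq, comul_coeff, map_sum]; rfl

variable (hS : Function.Bijective (HopfAlgebra.antipode k (A := H)))

/-- The images of the matrix coefficients under the inverse of the antipode. -/
def coeffInv (j i : ι) : H := (antipodeEquiv k H hS).symm (Y.coeff b j i)

omit [DecidableEq ι] [Fintype ι] in
theorem antipode_coeffInv (j i : ι) :
    HopfAlgebra.antipode k (Y.coeffInv b hS j i) = Y.coeff b j i :=
  (antipodeEquiv k H hS).apply_symm_apply _

theorem counit_coeffInv (j i : ι) :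
    Coalgebra.counit (R := k) (Y.coeffInv b hS j i) = if j = i then 1 else 0 := by
  rw [← counit_coeff Y b, ← antipode_coeffInv Y b hS, HopfAlgebra.counit_antipode]

theorem antipode_ite (p : Prop) [Decidable p] :
    HopfAlgebra.antipode k (if p then (1 : H) else 0) = if p then 1 else 0 := by
  split_ifs <;> simp

/-- The injective antihomomorphism `S` turns the sum into `∑ l, S(c j l) c l i`, which the antipode
axiom evaluates to `ε(c j i)`. The next relation uses the other antipode axiom. -/
theorem sum_coeffInv_mul_coeff (j i : ι) :
    ∑ l, Y.coeffInv b hS l i * Y.coeff b j l = if j = i then 1 else 0 := by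
  apply hS.1
  have h := HopfAlgebra.mul_antipode_rTensor_comul_apply (R := k) (Y.coeff b j i)
  rw [comul_coeff, counit_coeff] at h
  simp only [map_sum, LinearMap.rTensor_tmul, LinearMap.mul'_apply] at h
  simp only [map_sum, HopfAlgebra.antipode_mul_antidistrib, antipode_coeffInv, antipode_ite, h]
  split_ifs <;> simp

theorem sum_coeff_mul_coeffInv (j i : ι) :
    ∑ l, Y.coeff b l i * Y.coeffInv b hS j l = if j = i then 1 else 0 := by
  apply hS.1
  have h := HopfAlgebra.mul_antipode_lTensor_comul_apply (R := k) (Y.coeff b j i)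
  rw [comul_coeff, counit_coeff] at h
  simp only [map_sum, LinearMap.lTensor_tmul, LinearMap.mul'_apply] at h
  simp only [map_sum, HopfAlgebra.antipode_mul_antidistrib, antipode_coeffInv, antipode_ite, h]
  split_ifs <;> simp

/-- Anticomultiplicativity of `S⁻¹` on coefficients, obtained from uniqueness of inverses: the two
sides are inverses, from opposite sides, of the matrix with entries `Δ(c j i)` (`h1` and `h2`). -/
theorem comul_coeffInv (j i : ι) : Coalgebra.comul (R := k) (Y.coeffInv b hS j i) =
    ∑ l, Y.coeffInv b hS l i ⊗ₜ[k] Y.coeffInv b hS j l := by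
  have h1 : ∀ j i, ∑ l, Coalgebra.comul (R := k) (Y.coeffInv b hS l i) *
      Coalgebra.comul (R := k) (Y.coeff b j l) = if j = i then 1 else 0 := by
    intro j i
    simp only [← Bialgebra.comul_mul, ← map_sum, sum_coeffInv_mul_coeff]
    split_ifs <;> simp
  have h2 : ∀ j i, ∑ m, Coalgebra.comul (R := k) (Y.coeff b m i) *
      (∑ l, Y.coeffInv b hS l m ⊗ₜ[k] Y.coeffInv b hS j l) = if j = i then 1 else 0 := by
    intro j i
    calc _ = ∑ r, ∑ l, (∑ m, Y.coeff b m r * Y.coeffInv b hS l m) ⊗ₜ[k]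
          (Y.coeff b r i * Y.coeffInv b hS j l) := by
          simp only [comul_coeff, Finset.sum_mul_sum, Algebra.TensorProduct.tmul_mul_tmul,
            TensorProduct.sum_tmul]
          rw [Finset.sum_comm]
          exact Finset.sum_congr rfl fun r _ => Finset.sum_comm
      _ = (1 : H) ⊗ₜ[k] ∑ r, Y.coeff b r i * Y.coeffInv b hS j r := by
          rw [TensorProduct.tmul_sum]
          simp only [sum_coeff_mul_coeffInv, TensorProduct.ite_tmul, Finset.sum_ite_eq',
            Finset.mem_univ, if_true]
      _ = _ := by
          rw [sum_coeff_mul_coeffInv]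
          split_ifs <;> simp [Algebra.TensorProduct.one_def]
  calc _ = ∑ l, Coalgebra.comul (R := k) (Y.coeffInv b hS l i) * (if j = l then 1 else 0) := by
        simp
    _ = ∑ m, (∑ l, Coalgebra.comul (R := k) (Y.coeffInv b hS l i) *
          Coalgebra.comul (R := k) (Y.coeff b m l)) *
            (∑ l, Y.coeffInv b hS l m ⊗ₜ[k] Y.coeffInv b hS j l) := by
        simp only [← h2, Finset.mul_sum, Finset.sum_mul, mul_assoc]
        rw [Finset.sum_comm]
        exact Finset.sum_congr rfl fun m _ => Finset.sum_comm
    _ = _ := by simp [h1]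

theorem sweedler_coeffInv {M : Type*} [AddCommGroup M] [Module k M] {G : H → H → M}
    (hG : IsBilin k G) (j i : ι) :
    sweedler k (Y.coeffInv b hS j i) G =
      ∑ l, G (Y.coeffInv b hS l i) (Y.coeffInv b hS j l) := by
  rw [hG.sweedler_eq, comul_coeffInv, map_sum]; rfl

theorem isBilin_tensorAct_mul (x y : TensorAlgebra k W) :
    IsBilin k fun a c : H => Y.tensorAct a x * Y.tensorAct c y := by
  constructor <;> intro <;> constructor <;> intros <;> simp [add_mul, mul_add]

omit [DecidableEq ι] in
theorem tensorAct_coeff_mul (j i : ι) (x y : TensorAlgebra k W) :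
    Y.tensorAct (Y.coeff b j i) (x * y) =
      ∑ l, Y.tensorAct (Y.coeff b j l) x * Y.tensorAct (Y.coeff b l i) y := by
  rw [tensorAct_mul, sweedler_coeff _ _ (Y.isBilin_tensorAct_mul x y)]

theorem tensorAct_coeffInv_mul (j i : ι) (x y : TensorAlgebra k W) :
    Y.tensorAct (Y.coeffInv b hS j i) (x * y) =
      ∑ l, Y.tensorAct (Y.coeffInv b hS l i) x * Y.tensorAct (Y.coeffInv b hS j l) y := by
  rw [tensorAct_mul, sweedler_coeffInv _ _ _ (Y.isBilin_tensorAct_mul x y)]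

end YetterDrinfeld

namespace YetterDrinfeld

variable {k : Type u} {H : Type v} {W : Type w} [Field k] [Ring H] [HopfAlgebra k H]
  [AddCommGroup W] [Module k W] (Y : YetterDrinfeld k H W)

/-! ### Contraction with linear forms in the right tensor factor -/

/-- The map `x ⊗ y ↦ ξ(y) x`. -/
def contractRight {M N : Type*} [AddCommGroup M] [Module k M] [AddCommGroup N] [Module k N]
    (ξ : Module.Dual k N) : M ⊗[k] N →ₗ[k] M :=
  (TensorProduct.rid k M).toLinearMap ∘ₗ ξ.lTensor M

theorem contractRight_tmul {M N : Type*} [AddCommGroup M] [Module k M] [AddCommGroup N]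
    [Module k N] (ξ : Module.Dual k N) (x : M) (y : N) :
    contractRight ξ (x ⊗ₜ[k] y) = ξ y • x := by
  simp [contractRight]

theorem contractRight_map {M N M' N' : Type*} [AddCommGroup M] [Module k M] [AddCommGroup N]
    [Module k N] [AddCommGroup M'] [Module k M'] [AddCommGroup N'] [Module k N']
    (ξ : Module.Dual k N') (f : M →ₗ[k] M') (g : N →ₗ[k] N') (z : M ⊗[k] N) :
    contractRight ξ (TensorProduct.map f g z) = f (contractRight (ξ ∘ₗ g) z) := by
  induction z using TensorProduct.induction_on with
  | zero => simp
  | add x y hx hy => simp only [map_add, hx, hy]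
  | tmul x y => simp [contractRight_tmul]

/-- The component `x ↦ x₍₁₎ ⟨ξ, x₍₂₎⟩` of the comultiplication of `T(W)`, where `ξ ∈ W^*` is
extended by zero. -/
def skewDeriv (ξ : Module.Dual k W) : Module.End k (TensorAlgebra k W) :=
  contractRight (ξ ∘ₗ TensorAlgebra.ιInv) ∘ₗ Y.tensorComul

theorem skewDeriv_one (ξ : Module.Dual k W) : Y.skewDeriv ξ 1 = 0 := by
  simp [skewDeriv, tensorComul_one, contractRight_tmul, ιInv_one]

/-- Apply `id ⊗ ξ` to the recursion for `Δ`. In the braided term the linear part of `u q` with `u ∈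
W` is `ε(q) u`, so only `(id ⊗ ε) Δ(y) = y` remains. -/
theorem skewDeriv_ι_mul (ξ : Module.Dual k W) (w : W) (y : TensorAlgebra k W) :
    Y.skewDeriv ξ (TensorAlgebra.ι k w * y) = TensorAlgebra.ι k w * Y.skewDeriv ξ y +
      Y.tensorAct (contractRight ξ (Y.coact w)) y := by
  have hy : contractRight TensorAlgebra.algebraMapInv.toLinearMap (Y.tensorComul y) = y :=
    Y.lTensor_algebraMapInv_tensorComul y
  simp only [skewDeriv, LinearMap.comp_apply, tensorComul_ι_mul, map_add]
  nth_rewrite 4 [← hy]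
  congr 1
  · generalize Y.tensorComul y = Z
    induction Z using TensorProduct.induction_on with
    | zero => simp
    | add x y hx hy => simp only [map_add, mul_add, hx, hy]
    | tmul p q => simp [contractRight_tmul]
  · rw [tensorCoact_ι]
    generalize Y.tensorComul y = Z
    induction Z using TensorProduct.induction_on with
    | zero => simp
    | add x y hx hy => simp only [map_add, hx, hy]
    | tmul p q =>
      generalize Y.coact w = U
      induction U using TensorProduct.induction_on with
      | zero => simp
      | add x y hx hy => simp only [map_add, LinearMap.add_apply, hx, hy]
      | tmul m u =>
        simp [contractRight_tmul, actMul_tmul, ιInv_ι_mul, smul_smul, mul_comm]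

theorem ιInv_act (h : H) (y : TensorAlgebra k W) :
    TensorAlgebra.ιInv (Y.tensorAct h y) = Y.act h (TensorAlgebra.ιInv y) := by
  induction y using tensorAlgebra_left_induction with
  | one => simp [tensorAct_one_right, ιInv_one]
  | smul r x hx => simp only [map_smul, hx]
  | add x y hx hy => simp only [map_add, hx, hy]
  | ι_mul w y hy =>
    rw [tensorAct_mul, map_sweedler]
    simp only [tensorAct_ι, ιInv_ι_mul, algebraMapInv_act, mul_smul, map_smul]
    exact sweedler_counit_right (k := k)
      (f := fun a : H => (TensorAlgebra.algebraMapInv y : k) • Y.act a w)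
      (by constructor <;> intros <;> simp [smul_comm _ (TensorAlgebra.algebraMapInv y : k)]) h

/-- The relation `(id ⊗ ξ) Δ(h · x) = h₍₁₎ · (id ⊗ ξ h₍₂₎) Δ(x)`. -/
theorem skewDeriv_act (ξ : Module.Dual k W) (h : H) (x : TensorAlgebra k W) :
    Y.skewDeriv ξ (Y.tensorAct h x) =
      sweedler k h fun a c => Y.tensorAct a (Y.skewDeriv (ξ ∘ₗ Y.act c) x) := by
  simp only [skewDeriv, LinearMap.comp_apply, tensorComul_act, map_sweedler, contractRight_map]
  refine sweedler_congr fun a c => ?_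
  congr 3
  ext x
  simp [ιInv_act]

/-- Recovers the linear part of `x` from the counits of its derivatives; hence a skew-stable
subspace of `T(W)⁺` has no linear part. -/
theorem algebraMapInv_skewDeriv (ξ : Module.Dual k W) (x : TensorAlgebra k W) :
    TensorAlgebra.algebraMapInv (Y.skewDeriv ξ x) = ξ (TensorAlgebra.ιInv x) := by
  induction x using tensorAlgebra_left_induction with
  | one => simp [skewDeriv_one, ιInv_one]
  | smul r x hx => simp only [map_smul, hx]
  | add x y hx hy => simp only [map_add, hx, hy]
  | ι_mul w y hy =>
    rw [skewDeriv_ι_mul, map_add, algebraMapInv_ι_mul, algebraMapInv_act, ιInv_ι_mul, map_smul,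
      zero_add]
    have : Coalgebra.counit (R := k) (contractRight ξ (Y.coact w)) = ξ w := by
      nth_rewrite 2 [← Y.counit_coact w]
      generalize Y.coact w = U
      induction U using TensorProduct.induction_on with
      | zero => simp
      | add x y hx hy => simp only [map_add, hx, hy]
      | tmul m u => simp [contractRight_tmul, mul_comm]
    rw [this, smul_eq_mul, mul_comm]

variable {ι : Type*} [Fintype ι] (b : Module.Basis ι k W)

theorem skewDeriv_eq_sum (ξ : Module.Dual k W) (x : TensorAlgebra k W) :
    Y.skewDeriv ξ x = ∑ j, ξ (b j) • Y.skewDeriv (b.coord j) x := by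
  simp only [skewDeriv, LinearMap.comp_apply]
  generalize Y.tensorComul x = Z
  induction Z using TensorProduct.induction_on with
  | zero => simp
  | add x y hx hy => simp only [map_add, smul_add, Finset.sum_add_distrib, hx, hy]
  | tmul p q =>
    simp only [contractRight_tmul, smul_smul, ← Finset.sum_smul, LinearMap.comp_apply]
    congr 1
    conv_lhs => rw [← b.sum_dual_apply_smul_coord ξ]
    rw [LinearMap.sum_apply]
    rfl

omit [Fintype ι] in
theorem skewDeriv_basis_mul (i j : ι) (y : TensorAlgebra k W) :
    Y.skewDeriv (b.coord i) (TensorAlgebra.ι k (b j) * y) =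
      TensorAlgebra.ι k (b j) * Y.skewDeriv (b.coord i) y + Y.tensorAct (Y.coeff b j i) y :=
  Y.skewDeriv_ι_mul _ _ _

/-- The twist sits on the right factor. In the induction it is propagated by the comatrix formula
for `Δ(c j i)`, through `tensorAct_coeff_mul`. -/
theorem skewDeriv_mul (i : ι) (x y : TensorAlgebra k W) :
    Y.skewDeriv (b.coord i) (x * y) = x * Y.skewDeriv (b.coord i) y +
      ∑ j, Y.skewDeriv (b.coord j) x * Y.tensorAct (Y.coeff b j i) y := by
  induction x using tensorAlgebra_basis_induction b generalizing i with
  | one => simp [skewDeriv_one]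
  | smul r x hx =>
    simp only [smul_mul_assoc, map_smul, hx, smul_add, Finset.smul_sum]
  | add x x' hx hx' =>
    simp only [add_mul, map_add, hx, hx', Finset.sum_add_distrib]; abel
  | ι_mul j x hx =>
    simp only [mul_assoc, skewDeriv_basis_mul, hx, tensorAct_coeff_mul, add_mul, mul_add,
      Finset.sum_add_distrib, Finset.mul_sum]
    abel

/-- Coassociativity: `Δ(x₍₁₎ ⟨ξ, x₍₂₎⟩) = x₍₁₎ ⊗ x₍₂₎ ⟨ξ, x₍₃₎⟩`. -/
theorem tensorComul_skewDeriv (i : ι) (x : TensorAlgebra k W) :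
    Y.tensorComul (Y.skewDeriv (b.coord i) x) =
      (Y.skewDeriv (b.coord i)).lTensor _ (Y.tensorComul x) := by
  induction x using tensorAlgebra_basis_induction b with
  | one => simp [skewDeriv_one, tensorComul_one]
  | smul r x hx => simp only [map_smul, hx]
  | add x x' hx hx' => simp only [map_add, hx, hx']
  | ι_mul j x hx =>
    have hB : IsBilin k fun a c : H =>
        TensorProduct.map (Y.tensorAct a) (Y.tensorAct c) (Y.tensorComul x) := by
      constructor <;> intro <;> constructor <;> intros <;>
        simp [TensorProduct.map_add_left, TensorProduct.map_add_right,
          TensorProduct.map_smul_left, TensorProduct.map_smul_right]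
    -- By `H`-linearity `Δ(c j i · x)` is the sum over `l` of `c j l ⊗ c l i` acting on `Δ(x)`.
    -- These terms match those arising when `∂_i` hits the generators in the braided term.
    rw [skewDeriv_basis_mul, map_add, tensorComul_ι_mul, tensorComul_ι_mul, hx, tensorComul_act,
      sweedler_coeff Y b hB, tensorCoact_ι, coact_basis Y b]
    simp only [map_sum, map_add, LinearMap.lTensor_tmul, LinearMap.sum_apply]
    generalize Y.tensorComul x = Z
    induction Z using TensorProduct.induction_on with
    | zero => simp
    | add x y hx hy =>
      simp only [map_add, Finset.sum_add_distrib] at hx hy ⊢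
      have := congrArg₂ (· + ·) hx hy
      convert this using 1 <;> abel
    | tmul p q =>
      simp only [LinearMap.lTensor_tmul, LinearMap.rTensor_tmul, LinearMap.mulLeft_apply,
        actMul_tmul, TensorProduct.map_tmul, skewDeriv_basis_mul, TensorProduct.tmul_add,
        Finset.sum_add_distrib]
      abel

/-- Compatibility of the skew derivations of `T(W)` with the coaction. -/
theorem lTensor_skewDeriv_tensorCoact (i : ι) (x : TensorAlgebra k W) :
    (Y.skewDeriv (b.coord i)).lTensor H (Y.tensorCoact x) =
      ∑ j, Y.tensorCoact (Y.skewDeriv (b.coord j) x) * (Y.coeff b j i ⊗ₜ[k] 1) := by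
  induction x using tensorAlgebra_basis_induction b with
  | one => simp [skewDeriv_one, tensorCoact_one]
  | smul r x hx => simp only [map_smul, hx, smul_mul_assoc, Finset.smul_sum]
  | add x x' hx hx' => simp only [map_add, hx, hx', add_mul, Finset.sum_add_distrib]
  | ι_mul j x hx =>
    have hB1 : IsBilin k fun a c : H => Y.tensorCoact (Y.tensorAct a x) * (c ⊗ₜ[k] 1) := by
      constructor <;> intro <;> constructor <;> intros <;>
        simp [add_mul, mul_add, TensorProduct.add_tmul, ← TensorProduct.smul_tmul']
    have hB2 : IsBilin k fun a c : H =>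
        TensorProduct.map (LinearMap.mulLeft k a) (Y.tensorAct c) (Y.tensorCoact x) := by
      have e1 : ∀ a a' : H, LinearMap.mulLeft k (a + a') =
          LinearMap.mulLeft k a + LinearMap.mulLeft k a' := fun a a' => by ext; simp [add_mul]
      have e2 : ∀ (r : k) (a : H), LinearMap.mulLeft k (r • a) =
          r • LinearMap.mulLeft k a := fun r a => by ext; simp
      constructor <;> intro <;> constructor <;> intros <;>
        simp [e1, e2, TensorProduct.map_add_left, TensorProduct.map_add_right,
          TensorProduct.map_smul_left, TensorProduct.map_smul_right]
    -- The coefficients on the right of the coactions come from `Δ(c j i)`, so the Yetter–Drinfeld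
    -- condition at `h = c j i` moves them to the left.
    have yd := Y.sweedler_tensorCoact_act (Y.coeff b j i) x
    rw [sweedler_coeff Y b hB1, sweedler_coeff Y b hB2] at yd
    simp only [skewDeriv_basis_mul, map_add, add_mul, Finset.sum_add_distrib, yd,
      tensorCoact_mul, mul_assoc, ← Finset.mul_sum, ← hx]
    rw [tensorCoact_ι, coact_basis Y b]
    generalize Y.tensorCoact x = Z
    induction Z using TensorProduct.induction_on with
    | zero => simp
    | add x y hx hy =>
      simp only [map_add, mul_add, Finset.sum_add_distrib, hx, hy]
      abel
    | tmul g y =>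
      simp only [map_sum, LinearMap.lTensor_tmul, Finset.sum_mul,
        Algebra.TensorProduct.tmul_mul_tmul, skewDeriv_basis_mul, TensorProduct.tmul_add,
        TensorProduct.map_tmul, LinearMap.mulLeft_apply, Finset.sum_add_distrib]

end YetterDrinfeld

/-- Since `c⁻¹` swaps the factors, contracting its left output contracts `y`; only `S⁻¹` of the
contracted coaction remains, acting on `x`. This turns `∂_f` into skew derivations followed by the
action. -/
theorem lid_rTensor_invBraiding {k : Type u} {H : Type v} {B : Type w} [Field k] [Ring H]
    [HopfAlgebra k H] [Ring B] [Algebra k B]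
    (hS : Function.Bijective (HopfAlgebra.antipode k (A := H)))
    (act : H →ₗ[k] Module.End k B) (coact : B →ₗ[k] H ⊗[k] B) (ξ : Module.Dual k B) (x y : B) :
    TensorProduct.lid k B (ξ.rTensor B (invBraiding hS act coact (x ⊗ₜ y))) =
      act ((antipodeEquiv k H hS).symm (YetterDrinfeld.contractRight ξ (coact y))) x := by
  rw [invBraiding_tmul]
  generalize coact y = U
  induction U using TensorProduct.induction_on with
  | zero => simp
  | add x y hx hy => simp only [map_add, LinearMap.add_apply, hx, hy]
  | tmul m u => simp [YetterDrinfeld.contractRight_tmul]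

namespace YetterDrinfeld

variable {k : Type u} {H : Type v} {W : Type w} [Field k] [Ring H] [HopfAlgebra k H]
  [AddCommGroup W] [Module k W] (Y : YetterDrinfeld k H W)

theorem contractRight_algebraMapInv_tensorCoact (y : TensorAlgebra k W) :
    contractRight TensorAlgebra.algebraMapInv.toLinearMap (Y.tensorCoact y) =
      (TensorAlgebra.algebraMapInv y : k) • (1 : H) := by
  induction y using tensorAlgebra_left_induction with
  | one => simp [tensorCoact_one, contractRight_tmul]
  | smul r x hx => simp [hx, smul_smul]
  | add x y hx hy => simp [hx, hy, add_smul]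
  | ι_mul w y hy =>
    rw [algebraMapInv_ι_mul, tensorCoact_mul, tensorCoact_ι, zero_smul]
    generalize Y.coact w = U
    generalize Y.tensorCoact y = Z
    induction Z using TensorProduct.induction_on with
    | zero => simp
    | add x y hx hy => rw [mul_add, map_add, hx, hy, add_zero]
    | tmul g x =>
      induction U using TensorProduct.induction_on with
      | zero => simp
      | add x y hx hy => rw [map_add, add_mul, map_add, hx, hy, add_zero]
      | tmul m u => simp [contractRight_tmul, algebraMapInv_ι_mul]

/-- The projection of `T(W)` to `W` is colinear. -/
theorem lTensor_ιInv_tensorCoact (y : TensorAlgebra k W) :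
    TensorAlgebra.ιInv.lTensor H (Y.tensorCoact y) = Y.coact (TensorAlgebra.ιInv y) := by
  induction y using tensorAlgebra_left_induction with
  | one => simp [tensorCoact_one, ιInv_one]
  | smul r x hx => simp only [map_smul, hx]
  | add x y hx hy => simp only [map_add, hx, hy]
  | ι_mul w y hy =>
    have h := Y.contractRight_algebraMapInv_tensorCoact y
    rw [ιInv_ι_mul, tensorCoact_mul, tensorCoact_ι, map_smul]
    have e : ∀ U : H ⊗[k] W, (TensorAlgebra.algebraMapInv y : k) • U =
        (LinearMap.mulRight k ((TensorAlgebra.algebraMapInv y : k) • (1 : H))).rTensor W U := by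
      intro U
      induction U using TensorProduct.induction_on with
      | zero => simp
      | add x y hx hy => rw [smul_add, hx, hy, map_add]
      | tmul m u => simp [TensorProduct.smul_tmul']
    rw [e, ← h]
    generalize Y.coact w = U
    generalize Y.tensorCoact y = Z
    induction Z using TensorProduct.induction_on with
    | zero => simp [show LinearMap.mulRight k (0 : H) = 0 by ext; simp]
    | add x y hx hy =>
      have hadd : ∀ a c : H, LinearMap.mulRight k (a + c) =
          LinearMap.mulRight k a + LinearMap.mulRight k c := fun _ _ => by ext; simp [mul_add]
      rw [mul_add, map_add, hx, hy, map_add, hadd, LinearMap.rTensor_add, LinearMap.add_apply]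
    | tmul g x =>
      induction U using TensorProduct.induction_on with
      | zero => simp
      | add x y hx hy => rw [map_add, add_mul, map_add, hx, hy, map_add]
      | tmul m u => simp [contractRight_tmul, ιInv_ι_mul, TensorProduct.smul_tmul]

variable {ι : Type*} [Fintype ι] (b : Module.Basis ι k W)
  (hS : Function.Bijective (HopfAlgebra.antipode k (A := H)))

/-! ### Braided derivations of `T(W)` -/

/-- The canonical braided derivation of `T(W)` given by the `i`-th coordinate function. -/
def braidedDeriv (i : ι) : Module.End k (TensorAlgebra k W) :=
  ∑ j, Y.tensorAct (Y.coeffInv b hS j i) ∘ₗ Y.skewDeriv (b.coord j)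

theorem braidedDeriv_apply (i : ι) (x : TensorAlgebra k W) : Y.braidedDeriv b hS i x =
    ∑ j, Y.tensorAct (Y.coeffInv b hS j i) (Y.skewDeriv (b.coord j) x) := by
  simp [braidedDeriv]

theorem braidedDeriv_one (i : ι) : Y.braidedDeriv b hS i 1 = 0 := by
  simp [braidedDeriv_apply, skewDeriv_one]

theorem contractRight_coact (f : Module.Dual k W) (v : W) :
    contractRight f (Y.coact v) = ∑ i, f (b i) • ∑ j, b.coord j v • Y.coeff b j i := by
  conv_lhs => rw [← b.sum_repr v]
  simp only [map_sum, map_smul, coact_basis, contractRight_tmul, Finset.smul_sum,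
    Module.Basis.coord_apply]
  rw [Finset.sum_comm]
  exact Finset.sum_congr rfl fun i _ => Finset.sum_congr rfl fun j _ => smul_comm _ _ _

/-- Colinearity of the projection to `W` reduces the coaction of the second factor of `Δ(x)` to that
of its linear part, whose coefficients are the `c j i`. -/
theorem quantumDiff_tensorComul (f : Module.Dual k W) (x : TensorAlgebra k W) :
    quantumDiff hS Y.tensorAct Y.tensorCoact Y.tensorComul (f ∘ₗ TensorAlgebra.ιInv) x =
      ∑ i, f (b i) • Y.braidedDeriv b hS i x := by
  simp only [quantumDiff, LinearMap.comp_apply, LinearEquiv.coe_coe, braidedDeriv_apply, skewDeriv]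
  generalize Y.tensorComul x = Z
  induction Z using TensorProduct.induction_on with
  | zero => simp
  | add x y hx hy =>
    simp only [map_add, smul_add, Finset.sum_add_distrib, hx, hy]
  | tmul p q =>
    have e : contractRight (f ∘ₗ TensorAlgebra.ιInv) (Y.tensorCoact q) =
        contractRight f (Y.coact (TensorAlgebra.ιInv q)) := by
      rw [← lTensor_ιInv_tensorCoact, LinearMap.lTensor, contractRight_map, LinearMap.id_apply]
    rw [lid_rTensor_invBraiding, e, contractRight_coact Y b]
    simp [contractRight_tmul, coeffInv]

/-- Every structure map entering `∂_f` on `𝓑(W)` is induced from `T(W)`, so `∂_f` is induced by the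
corresponding operator there. -/
theorem nicholsDeriv_proj (f : Module.Dual k W) (x : TensorAlgebra k W) :
    Y.nicholsDeriv hS f (proj Y.nicholsIdeal x) =
      proj Y.nicholsIdeal (∑ i, f (b i) • Y.braidedDeriv b hS i x) := by
  rw [← quantumDiff_tensorComul]
  simp only [nicholsDeriv, quantumDiff, LinearMap.comp_apply, LinearEquiv.coe_coe, quotComul,
    quotLift_proj]
  generalize Y.tensorComul x = Z
  induction Z using TensorProduct.induction_on with
  | zero => simp
  | add x y hx hy => simp only [map_add, hx, hy]
  | tmul p q =>
    rw [lid_rTensor_invBraiding, TensorProduct.map_tmul, lid_rTensor_invBraiding]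
    have e : contractRight (f ∘ₗ Y.nicholsPrOne) (Y.quotCoact Y.nicholsIdeal Y.nicholsIdeal_coact
        ((proj Y.nicholsIdeal).toLinearMap q)) =
        contractRight (f ∘ₗ TensorAlgebra.ιInv) (Y.tensorCoact q) := by
      simp only [quotCoact, AlgHom.toLinearMap_apply, quotLift_proj, LinearMap.comp_apply]
      rw [LinearMap.lTensor, contractRight_map]
      rfl
    rw [e]
    rfl

variable [DecidableEq ι]

/-- In the term where the generator is differentiated, `y` is acted on by `∑ j, S⁻¹(c j i) c m j =
δ`, so its twist disappears. The remaining twist falls on the left factor. -/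
theorem braidedDeriv_basis_mul (i m : ι) (y : TensorAlgebra k W) :
    Y.braidedDeriv b hS i (TensorAlgebra.ι k (b m) * y) =
      ∑ j, Y.tensorAct (Y.coeffInv b hS j i) (TensorAlgebra.ι k (b m)) *
        Y.braidedDeriv b hS j y + if m = i then y else 0 := by
  simp only [braidedDeriv_apply, skewDeriv_basis_mul, map_add, tensorAct_coeffInv_mul,
    Finset.sum_add_distrib, Finset.mul_sum, ← tensorAct_mul_left]
  congr 1
  · exact Finset.sum_comm
  · rw [← LinearMap.sum_apply, ← map_sum, sum_coeffInv_mul_coeff]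
    split_ifs <;> simp [tensorAct_one]

theorem braidedDeriv_mul (i : ι) (x y : TensorAlgebra k W) :
    Y.braidedDeriv b hS i (x * y) =
      ∑ j, Y.tensorAct (Y.coeffInv b hS j i) x * Y.braidedDeriv b hS j y +
        Y.braidedDeriv b hS i x * y := by
  induction x using tensorAlgebra_basis_induction b generalizing i with
  | one => simp [braidedDeriv_one, tensorAct_one_right, counit_coeffInv]
  | smul r x hx => simp only [smul_mul_assoc, map_smul, hx, smul_add, Finset.smul_sum]
  | add x x' hx hx' => simp only [add_mul, map_add, hx, hx', Finset.sum_add_distrib]; abel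
  | ι_mul m x hx =>
    simp only [mul_assoc, braidedDeriv_basis_mul, hx, tensorAct_coeffInv_mul, add_mul, mul_add,
      Finset.sum_add_distrib, Finset.mul_sum, Finset.sum_mul, ite_mul, zero_mul]
    rw [Finset.sum_comm]
    abel

/-- Inverts the definition of `braidedDeriv` by the second inverse relation. It transfers stability
of an `H`-stable ideal from braided to skew derivations. -/
theorem skewDeriv_eq_sum_braidedDeriv (m : ι) (x : TensorAlgebra k W) :
    Y.skewDeriv (b.coord m) x =
      ∑ i, Y.tensorAct (Y.coeff b i m) (Y.braidedDeriv b hS i x) := by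
  simp only [braidedDeriv_apply, map_sum, ← tensorAct_mul_left]
  rw [Finset.sum_comm]
  simp only [← LinearMap.sum_apply, ← map_sum, sum_coeff_mul_coeffInv]
  rw [Finset.sum_eq_single m]
  · simp [tensorAct_one]
  · intro j _ hj; simp [hj]
  · simp

end YetterDrinfeld

namespace YetterDrinfeld

/-! ### Contraction with linear forms in the left tensor factor -/

section Contract

variable {k : Type u} [Field k] {M N M' N' : Type*} [AddCommGroup M] [Module k M] [AddCommGroup N]
  [Module k N] [AddCommGroup M'] [Module k M'] [AddCommGroup N'] [Module k N']

/-- The map `x ⊗ y ↦ φ(x) y`. -/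
def contractLeft (φ : Module.Dual k M) : M ⊗[k] N →ₗ[k] N :=
  (TensorProduct.lid k N).toLinearMap ∘ₗ φ.rTensor N

theorem contractLeft_tmul (φ : Module.Dual k M) (x : M) (y : N) :
    contractLeft φ (x ⊗ₜ[k] y) = φ x • y := by
  simp [contractLeft]

theorem contractLeft_map (φ : Module.Dual k M') (f : M →ₗ[k] M') (g : N →ₗ[k] N') (z : M ⊗[k] N) :
    contractLeft φ (TensorProduct.map f g z) = g (contractLeft (φ ∘ₗ f) z) := by
  induction z using TensorProduct.induction_on with
  | zero => simp
  | add x y hx hy => simp only [map_add, hx, hy]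
  | tmul x y => simp [contractLeft_tmul]

theorem apply_contractLeft (φ : Module.Dual k M) (ξ : Module.Dual k N) (z : M ⊗[k] N) :
    ξ (contractLeft φ z) = φ (contractRight ξ z) := by
  induction z using TensorProduct.induction_on with
  | zero => simp
  | add x y hx hy => simp only [map_add, hx, hy]
  | tmul x y => simp [contractLeft_tmul, contractRight_tmul, mul_comm]

theorem eq_zero_of_contractLeft_eq_zero {z : M ⊗[k] N}
    (h : ∀ φ : Module.Dual k M, contractLeft φ z = 0) : z = 0 := by
  classical
  let b := Module.Basis.ofVectorSpace k M
  apply (TensorProduct.equivFinsuppOfBasisLeft b).injective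
  rw [map_zero]
  ext i
  have e : ∀ z : M ⊗[k] N,
      TensorProduct.equivFinsuppOfBasisLeft b z i = contractLeft (b.coord i) z := by
    intro z
    induction z using TensorProduct.induction_on with
    | zero => simp
    | add x y hx hy => simp only [map_add, Finsupp.add_apply, hx, hy]
    | tmul x y => simp [contractLeft_tmul]
  rw [e, h, Finsupp.zero_apply]

theorem mem_range_lTensor_subtype (U : Submodule k N) {z : M ⊗[k] N}
    (h : ∀ φ : Module.Dual k M, contractLeft φ z ∈ U) :
    z ∈ LinearMap.range (U.subtype.lTensor M) := by
  have hex : Function.Exact U.subtype U.mkQ := by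
    rw [LinearMap.exact_iff, U.ker_mkQ, U.range_subtype]
  rw [← LinearMap.exact_iff.mp (lTensor_exact M hex U.mkQ_surjective), LinearMap.mem_ker]
  apply eq_zero_of_contractLeft_eq_zero
  intro φ
  rw [LinearMap.lTensor, contractLeft_map]
  exact (Submodule.Quotient.mk_eq_zero U).mpr (h φ)

/-- The sum of the two ranges is the kernel of `N ⊗ N → N/U ⊗ N/U`. Functionals on `N/U` separate
points there, and they are the functionals on `N` that vanish on `U`. -/
theorem mem_range_sup_range (U : Submodule k N) {z : N ⊗[k] N}
    (h : ∀ φ : Module.Dual k N, (∀ x ∈ U, φ x = 0) → contractLeft φ z ∈ U) :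
    z ∈ LinearMap.range (U.subtype.rTensor N) ⊔ LinearMap.range (U.subtype.lTensor N) := by
  have hex : Function.Exact U.subtype U.mkQ := by
    rw [LinearMap.exact_iff, U.ker_mkQ, U.range_subtype]
  rw [sup_comm, ← TensorProduct.map_ker hex U.mkQ_surjective hex U.mkQ_surjective,
    LinearMap.mem_ker]
  apply eq_zero_of_contractLeft_eq_zero
  intro φ
  rw [contractLeft_map]
  refine (Submodule.Quotient.mk_eq_zero U).mpr (h _ fun x hx => ?_)
  rw [LinearMap.comp_apply, U.mkQ_apply, (Submodule.Quotient.mk_eq_zero U).mpr hx, map_zero]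

end Contract

variable {k : Type u} {H : Type v} {W : Type w} [Field k] [Ring H] [HopfAlgebra k H]
  [AddCommGroup W] [Module k W] (Y : YetterDrinfeld k H W)
  {ι : Type*} [Fintype ι] (b : Module.Basis ι k W)

/-! ### The largest subspace of `T(W)⁺` stable under the skew derivations -/

/-- The subspace `U` lies in the kernel of the counit and is stable under the skew derivations. -/
structure IsSkewStable (U : Submodule k (TensorAlgebra k W)) : Prop where
  counit : ∀ x ∈ U, (TensorAlgebra.algebraMapInv x : k) = 0
  skewDeriv_mem : ∀ x ∈ U, ∀ i, Y.skewDeriv (b.coord i) x ∈ U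

/-- The largest subspace of `T(W)⁺` stable under the skew derivations. -/
def skewKernel : Submodule k (TensorAlgebra k W) := sSup {U | Y.IsSkewStable b U}

omit [Fintype ι] in
theorem isSkewStable_skewKernel : Y.IsSkewStable b (Y.skewKernel b) := by
  have h : ∀ x ∈ Y.skewKernel b, (TensorAlgebra.algebraMapInv x : k) = 0 ∧
      ∀ i, Y.skewDeriv (b.coord i) x ∈ Y.skewKernel b := by
    intro x hx
    rw [skewKernel, sSup_eq_iSup'] at hx
    induction hx using Submodule.iSup_induction' with
    | mem U x hx =>
      exact ⟨U.2.counit x hx, fun i => le_sSup (α := Submodule k _) U.2 (U.2.skewDeriv_mem x hx i)⟩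
    | zero => simp
    | add x y _ _ hx hy =>
      simp only [map_add, hx.1, hy.1, add_zero, true_and]
      exact fun i => add_mem (hx.2 i) (hy.2 i)
  exact ⟨fun x hx => (h x hx).1, fun x hx => (h x hx).2⟩

omit [Fintype ι] in
-- Maximality in usable form: to close the kernel under an operation, let `S` be all results of that
-- operation and check that a derivative of one is a combination of others.
theorem subset_skewKernel {S : Set (TensorAlgebra k W)}
    (h0 : ∀ x ∈ S, (TensorAlgebra.algebraMapInv x : k) = 0)
    (h1 : ∀ x ∈ S, ∀ i, Y.skewDeriv (b.coord i) x ∈ Submodule.span k S) {x : TensorAlgebra k W}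
    (hx : x ∈ S) : x ∈ Y.skewKernel b := by
  have hS : Y.IsSkewStable b (Submodule.span k S) := by
    constructor
    · intro x hx
      induction hx using Submodule.span_induction with
      | mem x hx => exact h0 x hx
      | zero => simp
      | add x y _ _ hx hy => simp [hx, hy]
      | smul r x _ hx => simp [hx]
    · intro x hx i
      induction hx using Submodule.span_induction with
      | mem x hx => exact h1 x hx i
      | zero => simp
      | add x y _ _ hx hy => rw [map_add]; exact add_mem hx hy
      | smul r x _ hx => rw [map_smul]; exact Submodule.smul_mem _ _ hx
  exact le_sSup (α := Submodule k _) hS (Submodule.subset_span hx)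

theorem skewDeriv_mem_skewKernel (ξ : Module.Dual k W) {x : TensorAlgebra k W}
    (hx : x ∈ Y.skewKernel b) : Y.skewDeriv ξ x ∈ Y.skewKernel b := by
  rw [Y.skewDeriv_eq_sum b]
  exact Submodule.sum_mem _ fun j _ => Submodule.smul_mem _ _
    ((Y.isSkewStable_skewKernel b).skewDeriv_mem x hx j)

theorem act_mem_skewKernel (h : H) {x : TensorAlgebra k W} (hx : x ∈ Y.skewKernel b) :
    Y.tensorAct h x ∈ Y.skewKernel b := by
  refine Y.subset_skewKernel b
    (S := {z | ∃ h : H, ∃ x ∈ Y.skewKernel b, Y.tensorAct h x = z}) ?_ ?_ ⟨h, x, hx, rfl⟩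
  · rintro _ ⟨h, x, hx, rfl⟩
    rw [algebraMapInv_act, (Y.isSkewStable_skewKernel b).counit x hx, mul_zero]
  · rintro _ ⟨h, x, hx, rfl⟩ i
    rw [skewDeriv_act]
    exact Submodule.sum_mem _ fun _ _ => Submodule.subset_span
      ⟨_, _, Y.skewDeriv_mem_skewKernel b _ hx, rfl⟩

/-- In the derivative of `x * y` the factor `y` is either differentiated or acted on by `H`, so
stability under the action is needed first. -/
theorem mul_mem_skewKernel_left (x : TensorAlgebra k W) {y : TensorAlgebra k W}
    (hy : y ∈ Y.skewKernel b) : x * y ∈ Y.skewKernel b := by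
  refine Y.subset_skewKernel b
    (S := {z | ∃ x, ∃ y ∈ Y.skewKernel b, x * y = z}) ?_ ?_ ⟨x, y, hy, rfl⟩
  · rintro _ ⟨x, y, hy, rfl⟩
    rw [map_mul, (Y.isSkewStable_skewKernel b).counit y hy, mul_zero]
  · rintro _ ⟨x, y, hy, rfl⟩ i
    rw [skewDeriv_mul]
    exact add_mem (Submodule.subset_span ⟨_, _, Y.skewDeriv_mem_skewKernel b _ hy, rfl⟩)
      (Submodule.sum_mem _ fun _ _ => Submodule.subset_span
        ⟨_, _, Y.act_mem_skewKernel b _ hy, rfl⟩)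

theorem mul_mem_skewKernel_right {x : TensorAlgebra k W} (y : TensorAlgebra k W)
    (hx : x ∈ Y.skewKernel b) : x * y ∈ Y.skewKernel b := by
  refine Y.subset_skewKernel b
    (S := {z | ∃ x ∈ Y.skewKernel b, ∃ y, x * y = z}) ?_ ?_ ⟨x, hx, y, rfl⟩
  · rintro _ ⟨x, hx, y, rfl⟩
    rw [map_mul, (Y.isSkewStable_skewKernel b).counit x hx, zero_mul]
  · rintro _ ⟨x, hx, y, rfl⟩ i
    rw [skewDeriv_mul]
    exact add_mem (Submodule.subset_span ⟨_, hx, _, rfl⟩)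
      (Submodule.sum_mem _ fun _ _ => Submodule.subset_span
        ⟨_, Y.skewDeriv_mem_skewKernel b _ hx, _, rfl⟩)

/-- Moving `∂_i` through the coaction costs right multiplication by some `c j i` in `H`, which is
absorbed into `φ`; hence the set `S` ranges over all functionals. -/
theorem coact_mem_skewKernel {x : TensorAlgebra k W} (hx : x ∈ Y.skewKernel b)
    (φ : Module.Dual k H) : contractLeft φ (Y.tensorCoact x) ∈ Y.skewKernel b := by
  refine Y.subset_skewKernel b (S := {z | ∃ φ : Module.Dual k H, ∃ x ∈ Y.skewKernel b,
    contractLeft φ (Y.tensorCoact x) = z}) ?_ ?_ ⟨φ, x, hx, rfl⟩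
  · rintro _ ⟨φ, x, hx, rfl⟩
    rw [← AlgHom.toLinearMap_apply]
    refine (apply_contractLeft φ _ _).trans ?_
    rw [contractRight_algebraMapInv_tensorCoact, (Y.isSkewStable_skewKernel b).counit x hx,
      zero_smul, map_zero]
  · rintro _ ⟨φ, x, hx, rfl⟩ i
    have e1 : ∀ z : H ⊗[k] TensorAlgebra k W, Y.skewDeriv (b.coord i) (contractLeft φ z) =
        contractLeft φ ((Y.skewDeriv (b.coord i)).lTensor H z) := fun z => by
      rw [LinearMap.lTensor, contractLeft_map, LinearMap.comp_id]
    have e2 : ∀ (c : H) (z : H ⊗[k] TensorAlgebra k W), contractLeft φ (z * (c ⊗ₜ[k] 1)) =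
        contractLeft (φ ∘ₗ LinearMap.mulRight k c) z := fun c z => by
      induction z using TensorProduct.induction_on with
      | zero => simp
      | add x y hx hy => simp only [add_mul, map_add, hx, hy]
      | tmul x y => simp [contractLeft_tmul]
    rw [e1, lTensor_skewDeriv_tensorCoact, map_sum]
    simp only [e2]
    exact Submodule.sum_mem _ fun _ _ => Submodule.subset_span
      ⟨_, _, Y.skewDeriv_mem_skewKernel b _ hx, rfl⟩

/-- By coassociativity `∂_i` acts only on the second factor of `Δ(x)`, so `φ` stays fixed. The
counit of the contraction is `φ(x)`, which is where the vanishing of `φ` enters. -/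
theorem comul_mem_skewKernel {x : TensorAlgebra k W} (hx : x ∈ Y.skewKernel b)
    (φ : Module.Dual k (TensorAlgebra k W)) (hφ : ∀ x ∈ Y.skewKernel b, φ x = 0) :
    contractLeft φ (Y.tensorComul x) ∈ Y.skewKernel b := by
  refine Y.subset_skewKernel b (S := {z | ∃ x ∈ Y.skewKernel b,
    contractLeft φ (Y.tensorComul x) = z}) ?_ ?_ ⟨x, hx, rfl⟩
  · rintro _ ⟨x, hx, rfl⟩
    rw [← AlgHom.toLinearMap_apply]
    refine (apply_contractLeft φ _ _).trans ?_
    exact (congrArg φ (Y.lTensor_algebraMapInv_tensorComul x)).trans (hφ x hx)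
  · rintro _ ⟨x, hx, rfl⟩ i
    have e1 : ∀ z : TensorAlgebra k W ⊗[k] TensorAlgebra k W,
        Y.skewDeriv (b.coord i) (contractLeft φ z) =
        contractLeft φ ((Y.skewDeriv (b.coord i)).lTensor _ z) := fun z => by
      rw [LinearMap.lTensor, contractLeft_map, LinearMap.comp_id]
    rw [e1, ← tensorComul_skewDeriv]
    exact Submodule.subset_span ⟨_, Y.skewDeriv_mem_skewKernel b _ hx, rfl⟩

theorem ιInv_eq_zero_of_mem_skewKernel {x : TensorAlgebra k W} (hx : x ∈ Y.skewKernel b) :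
    (TensorAlgebra.ιInv x : W) = 0 := by
  refine b.ext_elem fun i => ?_
  have h := (Y.isSkewStable_skewKernel b).counit _ (Y.skewDeriv_mem_skewKernel b (b.coord i) hx)
  rw [algebraMapInv_skewDeriv] at h
  simpa using h

/-! ### The grading of `T(W)` -/

local notation "𝒯" => fun n : ℕ => LinearMap.range (TensorAlgebra.ι k : W →ₗ[k] _) ^ n

theorem tensorAct_mem_pow (h : H) (n : ℕ) {x : TensorAlgebra k W} (hx : x ∈ 𝒯 n) :
    Y.tensorAct h x ∈ 𝒯 n := by
  induction n generalizing h x with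
  | zero =>
    simp only [pow_zero] at hx ⊢
    obtain ⟨r, rfl⟩ := Submodule.mem_one.mp hx
    rw [Algebra.algebraMap_eq_smul_one, map_smul, tensorAct_one_right]
    exact Submodule.smul_mem _ _ (Submodule.smul_mem _ _ (Submodule.one_le.mp le_rfl))
  | succ n ih =>
    simp only [pow_succ'] at hx ⊢
    induction hx using Submodule.mul_induction_on' with
    | mem_mul_mem v hv y hy =>
      obtain ⟨w, rfl⟩ := hv
      rw [tensorAct_mul]
      refine Submodule.sum_mem _ fun _ _ => Submodule.mul_mem_mul ?_ (ih _ hy)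
      rw [tensorAct_ι]; exact ⟨_, rfl⟩
    | add x _ y _ hx hy => rw [map_add]; exact add_mem hx hy

theorem skewDeriv_mem_pow (ξ : Module.Dual k W) (n : ℕ) {x : TensorAlgebra k W}
    (hx : x ∈ 𝒯 (n + 1)) : Y.skewDeriv ξ x ∈ 𝒯 n := by
  induction n generalizing x with
  | zero =>
    simp only [zero_add, pow_one] at hx
    obtain ⟨w, rfl⟩ := hx
    rw [← mul_one (TensorAlgebra.ι k w), skewDeriv_ι_mul, skewDeriv_one, mul_zero, zero_add]
    exact Y.tensorAct_mem_pow _ 0 (by simp only [pow_zero]; exact Submodule.one_le.mp le_rfl)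
  | succ n ih =>
    have hx' : x ∈ LinearMap.range (TensorAlgebra.ι k : W →ₗ[k] _) *
      LinearMap.range (TensorAlgebra.ι k : W →ₗ[k] _) ^ (n + 1) := by rwa [← pow_succ']
    clear hx
    induction hx' using Submodule.mul_induction_on' with
    | mem_mul_mem v hv y hy =>
      obtain ⟨w, rfl⟩ := hv
      rw [skewDeriv_ι_mul]
      refine add_mem ?_ (Y.tensorAct_mem_pow _ _ hy)
      have := Submodule.mul_mem_mul (LinearMap.mem_range_self (TensorAlgebra.ι k) w) (ih hy)
      rwa [← pow_succ'] at this
    | add x hx y hy hx' hy' =>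
      rw [map_add]
      exact add_mem hx' hy'

theorem skewDeriv_eq_zero_of_mem_pow_zero (ξ : Module.Dual k W) {x : TensorAlgebra k W}
    (hx : x ∈ 𝒯 0) : Y.skewDeriv ξ x = 0 := by
  simp only [pow_zero] at hx
  obtain ⟨r, rfl⟩ := Submodule.mem_one.mp hx
  rw [Algebra.algebraMap_eq_smul_one, map_smul, skewDeriv_one, smul_zero]

theorem algebraMapInv_eq_zero_of_mem_pow_succ (n : ℕ) {x : TensorAlgebra k W}
    (hx : x ∈ 𝒯 (n + 1)) : (TensorAlgebra.algebraMapInv x : k) = 0 := by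
  simp only [pow_succ'] at hx
  induction hx using Submodule.mul_induction_on' with
  | mem_mul_mem v hv y hy => obtain ⟨w, rfl⟩ := hv; exact algebraMapInv_ι_mul w y
  | add x _ y _ hx hy => rw [map_add, hx, hy, add_zero]

theorem ιInv_eq_zero_of_mem_pow {n : ℕ} (hn : n ≠ 1) {x : TensorAlgebra k W} (hx : x ∈ 𝒯 n) :
    (TensorAlgebra.ιInv x : W) = 0 := by
  obtain _ | _ | n := n
  · simp only [pow_zero] at hx
    obtain ⟨r, rfl⟩ := Submodule.mem_one.mp hx
    rw [Algebra.algebraMap_eq_smul_one, map_smul, ιInv_one, smul_zero]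
  · exact absurd rfl hn
  · have hx' : x ∈ LinearMap.range (TensorAlgebra.ι k : W →ₗ[k] _) *
      LinearMap.range (TensorAlgebra.ι k : W →ₗ[k] _) ^ (n + 1) := by rwa [← pow_succ']
    clear hx
    induction hx' using Submodule.mul_induction_on' with
    | mem_mul_mem v hv y hy =>
      obtain ⟨w, rfl⟩ := hv
      rw [ιInv_ι_mul, algebraMapInv_eq_zero_of_mem_pow_succ n hy, zero_smul]
    | add x hx y hy hx' hy' =>
      rw [map_add, hx', hy', add_zero]

/-- The projection of `T(W)` to its component of degree `n`. -/
abbrev gradedProj (n : ℕ) : Module.End k (TensorAlgebra k W) := GradedAlgebra.proj 𝒯 n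

theorem gradedProj_of_mem {n : ℕ} {x : TensorAlgebra k W} (hx : x ∈ 𝒯 n) :
    gradedProj n x = x :=
  DirectSum.decompose_of_mem_same 𝒯 hx

theorem gradedProj_of_mem_of_ne {m n : ℕ} (h : m ≠ n) {x : TensorAlgebra k W} (hx : x ∈ 𝒯 m) :
    gradedProj n x = 0 :=
  DirectSum.decompose_of_mem_ne 𝒯 hx h

theorem graded_induction {p : TensorAlgebra k W → Prop} (h : ∀ n, ∀ x ∈ 𝒯 n, p x)
    (hadd : ∀ x y, p x → p y → p (x + y)) (x : TensorAlgebra k W) : p x :=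
  DirectSum.Decomposition.inductionOn 𝒯 (h 0 0 (zero_mem _)) (fun {i} m => h i m m.2) hadd x

theorem skewDeriv_gradedProj_zero (ξ : Module.Dual k W) (x : TensorAlgebra k W) :
    Y.skewDeriv ξ (gradedProj 0 x) = 0 :=
  Y.skewDeriv_eq_zero_of_mem_pow_zero ξ (DirectSum.decompose 𝒯 x 0).2

theorem skewDeriv_gradedProj_succ (ξ : Module.Dual k W) (n : ℕ) (x : TensorAlgebra k W) :
    Y.skewDeriv ξ (gradedProj (n + 1) x) = gradedProj n (Y.skewDeriv ξ x) := by
  induction x using graded_induction with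
  | hadd x y hx hy => simp only [map_add, hx, hy]
  | h m x hx =>
    obtain _ | m := m
    · rw [gradedProj_of_mem_of_ne (by simp) hx, Y.skewDeriv_eq_zero_of_mem_pow_zero ξ hx, map_zero,
        map_zero]
    · by_cases h : m = n
      · subst h
        rw [gradedProj_of_mem hx, gradedProj_of_mem (Y.skewDeriv_mem_pow ξ m hx)]
      · rw [gradedProj_of_mem_of_ne (by simpa using h) hx,
          gradedProj_of_mem_of_ne h (Y.skewDeriv_mem_pow ξ m hx), map_zero]

theorem algebraMapInv_gradedProj_zero (x : TensorAlgebra k W) :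
    (TensorAlgebra.algebraMapInv (gradedProj 0 x) : k) = TensorAlgebra.algebraMapInv x := by
  induction x using graded_induction with
  | hadd x y hx hy => simp only [map_add, hx, hy]
  | h m x hx =>
    obtain _ | m := m
    · rw [gradedProj_of_mem hx]
    · rw [gradedProj_of_mem_of_ne (by simp) hx, algebraMapInv_eq_zero_of_mem_pow_succ m hx,
        map_zero]

theorem gradedProj_one_eq (x : TensorAlgebra k W) :
    gradedProj 1 x = TensorAlgebra.ι k (TensorAlgebra.ιInv x) := by
  induction x using graded_induction with
  | hadd x y hx hy => simp only [map_add, hx, hy]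
  | h m x hx =>
    by_cases h : m = 1
    · subst h
      rw [gradedProj_of_mem hx]
      simp only [pow_one] at hx
      obtain ⟨w, rfl⟩ := hx
      rw [TensorAlgebra.ι_leftInverse]
    · rw [gradedProj_of_mem_of_ne h hx, ιInv_eq_zero_of_mem_pow h hx, map_zero]

/-- Skew derivations lower the degree by one, so a derivative of a component of `x` is a component
of a derivative of `x`, or zero in degree `0`. -/
theorem gradedProj_mem_skewKernel (n : ℕ) {x : TensorAlgebra k W} (hx : x ∈ Y.skewKernel b) :
    gradedProj n x ∈ Y.skewKernel b := by
  refine Y.subset_skewKernel b (S := {z | ∃ n : ℕ, ∃ x ∈ Y.skewKernel b,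
    gradedProj n x = z}) ?_ ?_ ⟨n, x, hx, rfl⟩
  · rintro _ ⟨_ | n, x, hx, rfl⟩
    · rw [algebraMapInv_gradedProj_zero, (Y.isSkewStable_skewKernel b).counit x hx]
    · exact algebraMapInv_eq_zero_of_mem_pow_succ n (DirectSum.decompose 𝒯 x (n + 1)).2
  · rintro _ ⟨_ | n, x, hx, rfl⟩ i
    · rw [skewDeriv_gradedProj_zero]; exact zero_mem _
    · rw [skewDeriv_gradedProj_succ]
      exact Submodule.subset_span ⟨_, _, Y.skewDeriv_mem_skewKernel b _ hx, rfl⟩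

/-! ### The kernel is an ideal of relations of the Nichols algebra -/

/-- The subspace `skewKernel` as an ideal. -/
def skewIdeal : Ideal (TensorAlgebra k W) :=
  { Y.skewKernel b with
    smul_mem' := fun c _ hx => Y.mul_mem_skewKernel_left b c hx }

theorem isNicholsRelationIdeal_skewIdeal : Y.IsNicholsRelationIdeal (Y.skewIdeal b) where
  isTwoSided := ⟨fun y hx => Y.mul_mem_skewKernel_right b y hx⟩
  homogeneous := fun n _ hx => Y.gradedProj_mem_skewKernel b n hx
  degree_zero := (Y.isSkewStable_skewKernel b).counit
  degree_one := fun _ hx => Y.ιInv_eq_zero_of_mem_skewKernel b hx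
  act_mem := fun h _ hx => Y.act_mem_skewKernel b h hx
  coact_mem := fun _ hx => mem_range_lTensor_subtype _ fun φ => Y.coact_mem_skewKernel b hx φ
  comul_mem := fun _ hx => mem_range_sup_range _ fun φ hφ => Y.comul_mem_skewKernel b hx φ hφ

/-- `I` is not asked to be homogeneous, a subcomodule or a coideal: the larger `skewIdeal` has these
properties. -/
theorem le_nicholsIdeal_of_skewDeriv_mem (I : Ideal (TensorAlgebra k W))
    (h0 : ∀ x ∈ I, (TensorAlgebra.algebraMapInv x : k) = 0)
    (h1 : ∀ x ∈ I, ∀ i, Y.skewDeriv (b.coord i) x ∈ I) : I ≤ Y.nicholsIdeal := fun x hx => by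
  have hI : Y.IsSkewStable b (I.restrictScalars k) := ⟨h0, h1⟩
  have hx' : x ∈ Y.skewKernel b := le_sSup (α := Submodule k _) hI hx
  exact le_sSup (α := Ideal _) (Y.isNicholsRelationIdeal_skewIdeal b) hx'

end YetterDrinfeld

namespace YetterDrinfeld

variable {k : Type u} {H : Type v} {W : Type w} [Field k] [Ring H] [HopfAlgebra k H]
  [AddCommGroup W] [Module k W] (Y : YetterDrinfeld k H W)
  {ι : Type*} [Fintype ι] (b : Module.Basis ι k W)
  (hS : Function.Bijective (HopfAlgebra.antipode k (A := H)))

/-! ### The coaction of the dual in coordinates -/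

theorem dualCoact_eq [FiniteDimensional k W] (f : Module.Dual k W) :
    Y.dualCoact hS f = ∑ j, (∑ i, f (b i) • Y.coeffInv b hS j i) ⊗ₜ[k] b.coord j := by
  have h : (antipodeEquiv k H hS).symm.toLinearMap ∘ₗ (TensorProduct.rid k H).toLinearMap ∘ₗ
      f.lTensor H ∘ₗ Y.coact = dualTensorHomEquiv (R := k) (M := W) (N := H)
        (∑ j, b.coord j ⊗ₜ[k] ∑ i, f (b i) • Y.coeffInv b hS j i) := by
    ext v
    refine (congrArg (antipodeEquiv k H hS).symm (Y.contractRight_coact b f v)).trans ?_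
    have e : ∀ (φ : Module.Dual k W) (h : H), dualTensorHomEquiv (R := k) (M := W) (N := H)
        (φ ⊗ₜ h) v = φ v • h := fun _ _ => by simp [dualTensorHomEquiv]
    simp only [map_sum, map_smul, LinearMap.sum_apply, e, Finset.smul_sum]
    rw [Finset.sum_comm]
    exact Finset.sum_congr rfl fun j _ => Finset.sum_congr rfl fun i _ => smul_comm _ _ _
  rw [dualCoact, h, LinearEquiv.symm_apply_apply]
  simp

/-! ### Ideals -/

variable {I : Ideal (TensorAlgebra k W)}

theorem ιInv_eq_zero_of_isHomogeneousIdeal (hI : IsHomogeneousIdeal I)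
    (hW : ∀ w : W, TensorAlgebra.ι k w ∈ I → w = 0) {x : TensorAlgebra k W} (hx : x ∈ I) :
    (TensorAlgebra.ιInv x : W) = 0 := by
  refine hW _ ?_
  rw [← gradedProj_one_eq]
  exact hI 1 hx

/-- Apply `id ⊗ ξ` to `I ⊗ T(W) + T(W) ⊗ I`: the first summand lands in `I`, and the second dies
because `I` has no linear part. -/
theorem IsComulStable.skewDeriv_mem (hI : Y.IsComulStable I)
    (hI1 : ∀ x ∈ I, (TensorAlgebra.ιInv x : W) = 0) (ξ : Module.Dual k W) {x : TensorAlgebra k W}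
    (hx : x ∈ I) : Y.skewDeriv ξ x ∈ I := by
  obtain ⟨_, ⟨s, rfl⟩, _, ⟨t, rfl⟩, hst⟩ := Submodule.mem_sup.mp (hI x hx)
  have h1 : (ξ ∘ₗ TensorAlgebra.ιInv) ∘ₗ (I.restrictScalars k).subtype = 0 :=
    LinearMap.ext fun y => (congrArg ξ (hI1 y y.2)).trans (map_zero ξ)
  rw [skewDeriv, LinearMap.comp_apply, ← hst, map_add, LinearMap.rTensor, LinearMap.lTensor,
    contractRight_map, contractRight_map, LinearMap.id_apply, h1]
  have h0 : contractRight (0 : Module.Dual k (I.restrictScalars k)) t = 0 := by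
    simp [contractRight]
  rw [h0, add_zero]
  exact (contractRight _ s).2

theorem IsActStable.braidedDeriv_mem (hI : Y.IsActStable I)
    (h : ∀ x ∈ I, ∀ j, Y.skewDeriv (b.coord j) x ∈ I) (i : ι) {x : TensorAlgebra k W}
    (hx : x ∈ I) : Y.braidedDeriv b hS i x ∈ I := by
  rw [braidedDeriv_apply]
  exact Submodule.sum_mem _ fun j _ => hI _ _ (h x hx j)

variable [I.IsTwoSided]

theorem proj_surjective : Function.Surjective (proj (k := k) (W := W) I) :=
  Ideal.Quotient.mk_surjective

theorem quotAct_proj (hI : Y.IsActStable I) (h : H) (x : TensorAlgebra k W) :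
    Y.quotAct I hI h (proj I x) = proj I (Y.tensorAct h x) := rfl

/-- A family of braided derivations of `T(W)/I`, if the braided derivations of `T(W)` preserve
the ideal `I`. -/
theorem exists_isBraidedDerivationFamily [DecidableEq ι] [FiniteDimensional k W]
    (hI : Y.IsActStable I) (h : ∀ i, ∀ x ∈ I, Y.braidedDeriv b hS i x ∈ I) :
    ∃ d : Module.Dual k W → Module.End k (TensorAlgebra k W ⧸ I),
      Y.IsBraidedDerivationFamily hS I hI d := by
  let D : ι → Module.End k (TensorAlgebra k W ⧸ I) := fun i =>
    quotLift I ((proj I).toLinearMap ∘ₗ Y.braidedDeriv b hS i) fun x hx => proj_eq_zero I (h i x hx)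
  have hD : ∀ i x, D i (proj I x) = proj I (Y.braidedDeriv b hS i x) := fun i x => rfl
  have hDmul : ∀ i x y, D i (x * y) =
      ∑ j, Y.quotAct I hI (Y.coeffInv b hS j i) x * D j y + D i x * y := by
    intro i x y
    obtain ⟨x, rfl⟩ := proj_surjective x
    obtain ⟨y, rfl⟩ := proj_surjective y
    simp only [← map_mul, hD, quotAct_proj, braidedDeriv_mul, map_add, map_sum]
  refine ⟨fun f => ∑ i, f (b i) • D i, ?_, ?_⟩
  · intro f n hs g hf x y
    -- The Leibniz rule is required for every expression of the coaction of `f`. As `Φ` is linear on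
    -- the tensor product, it suffices to verify the rule for the coordinate expression.
    let Φ : H ⊗[k] Module.Dual k W →ₗ[k] TensorAlgebra k W ⧸ I :=
      TensorProduct.lift (LinearMap.mk₂ k
        (fun (a : H) (f : Module.Dual k W) => Y.quotAct I hI a x * (∑ i, f (b i) • D i) y)
        (fun _ _ _ => by simp [add_mul]) (fun _ _ _ => by simp)
        (fun _ _ _ => by simp [add_smul, Finset.sum_add_distrib, mul_add])
        (fun _ _ _ => by
          simp only [LinearMap.sum_apply, LinearMap.smul_apply, mul_smul, smul_eq_mul,
            ← Finset.smul_sum, mul_smul_comm]))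
    have hΦ : ∀ a f, Φ (a ⊗ₜ f) = Y.quotAct I hI a x * (∑ i, f (b i) • D i) y := fun _ _ => rfl
    have h1 := congrArg Φ hf
    rw [dualCoact_eq Y b hS] at h1
    simp only [map_sum, hΦ] at h1
    rw [← h1]
    have h2 : ∀ j, ∑ i, b.coord j (b i) • D i = D j := fun j => by
      simp [Finsupp.single_apply]
    simp only [h2, LinearMap.sum_apply, LinearMap.smul_apply, hDmul, smul_add,
      Finset.sum_add_distrib, map_smul, Finset.sum_mul, smul_mul_assoc, Finset.smul_sum]
    rw [Finset.sum_comm]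
  · intro f v
    have h3 : ∀ i, D i (proj I (TensorAlgebra.ι k v)) = algebraMap k _ (b.coord i v) := by
      intro i
      have e : D i ∘ₗ (proj I).toLinearMap ∘ₗ TensorAlgebra.ι k =
          Algebra.linearMap k _ ∘ₗ b.coord i := b.ext fun m => by
        change D i (proj I (TensorAlgebra.ι k (b m))) = algebraMap k _ (b.coord i (b m))
        rw [hD, ← mul_one (TensorAlgebra.ι k (b m)), braidedDeriv_basis_mul]
        simp only [braidedDeriv_one, mul_zero, Finset.sum_const_zero, zero_add,
          Module.Basis.coord_apply, Module.Basis.repr_self, Finsupp.single_apply]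
        split_ifs <;> simp
      exact LinearMap.congr_fun e v
    have h4 : f v = ∑ i, f (b i) * b.coord i v := by
      conv_lhs => rw [← b.sum_dual_apply_smul_coord f]
      rw [LinearMap.sum_apply]
      rfl
    simp only [LinearMap.sum_apply, LinearMap.smul_apply, h3]
    rw [h4, map_sum]
    simp only [map_mul, Algebra.smul_def]

/-! ### Rigidity of braided derivation families. -/

namespace IsBraidedDerivationFamily

variable {Y hS} [DecidableEq ι] [FiniteDimensional k W] {hI : Y.IsActStable I}
  {d : Module.Dual k W → Module.End k (TensorAlgebra k W ⧸ I)}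

/-- Linearity in `f` is not part of the definition; it is forced by the Leibniz rule holding for all
expressions of one tensor. -/
theorem eq_sum {n : ℕ} (b : Module.Basis (Fin n) k W)
    (hd : Y.IsBraidedDerivationFamily hS I hI d) (f : Module.Dual k W)
    (y : TensorAlgebra k W ⧸ I) : d f y = ∑ j, f (b j) • d (b.coord j) y := by
  have h1 := hd.leibniz f n _ _ (dualCoact_eq Y b hS f) 1 y
  -- The coordinate expression with the zero tensor `1 ⊗ f - ∑ j, f (b j) 1 ⊗ b^j` added. Comparing
  -- the two rules at `x = 1` leaves the claim.
  have h2 := hd.leibniz f (n + 1)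
    (Fin.cons 1 fun j => (∑ i, f (b i) • Y.coeffInv b hS j i) - f (b j) • 1)
    (Fin.cons f fun j => b.coord j) (by
      simp only [Fin.sum_univ_succ, Fin.cons_zero, Fin.cons_succ, TensorProduct.sub_tmul,
        Finset.sum_sub_distrib, TensorProduct.smul_tmul, ← TensorProduct.tmul_sum,
        b.sum_dual_apply_smul_coord, dualCoact_eq Y b hS f]
      abel) 1 y
  have e : ∀ (r : k), Y.quotAct I hI (r • (1 : H)) 1 = r • (1 : TensorAlgebra k W ⧸ I) := by
    intro r
    rw [map_smul, LinearMap.smul_apply, ← map_one (proj I), quotAct_proj, tensorAct_one]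
  have e1 : Y.quotAct I hI (1 : H) 1 = (1 : TensorAlgebra k W ⧸ I) := by simpa using e 1
  rw [h1] at h2
  simp only [Fin.sum_univ_succ, Fin.cons_zero, Fin.cons_succ, map_sub, LinearMap.sub_apply,
    sub_mul, Finset.sum_sub_distrib, e, e1, smul_mul_assoc, one_mul] at h2
  have h3 := add_right_cancel h2
  rw [← sub_eq_zero, ← sub_eq_zero.mpr h3.symm]
  abel

theorem leibniz_coord (hd : Y.IsBraidedDerivationFamily hS I hI d) {n : ℕ}
    (b : Module.Basis (Fin n) k W) (i : Fin n) (x y : TensorAlgebra k W ⧸ I) :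
    d (b.coord i) (x * y) = ∑ j, Y.quotAct I hI (Y.coeffInv b hS j i) x * d (b.coord j) y +
      d (b.coord i) x * y := by
  refine hd.leibniz _ n _ _ ?_ x y
  rw [dualCoact_eq Y b hS]
  simp [Finsupp.single_apply]

theorem apply_coord_proj (hd : Y.IsBraidedDerivationFamily hS I hI d) {n : ℕ}
    (b : Module.Basis (Fin n) k W) (i : Fin n) (x : TensorAlgebra k W) :
    d (b.coord i) (proj I x) = proj I (Y.braidedDeriv b hS i x) := by
  induction x using tensorAlgebra_basis_induction b generalizing i with
  | one =>
    -- The rule for `1 * 1` reads `d(1) = d(1) + d(1)`, so `d(1) = 0`.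
    have h := hd.leibniz_coord b i 1 1
    have e : ∀ j, Y.quotAct I hI (Y.coeffInv b hS j i) 1 =
        if j = i then (1 : TensorAlgebra k W ⧸ I) else 0 := by
      intro j
      rw [← map_one (proj I), quotAct_proj, tensorAct_one_right, counit_coeffInv]
      split_ifs <;> simp
    simp only [e, mul_one, ite_mul, one_mul, zero_mul, Finset.sum_ite_eq', Finset.mem_univ,
      if_true] at h
    rw [braidedDeriv_one, map_zero, map_one]
    exact left_eq_add.mp h
  | smul r x hx => simp only [map_smul, hx]
  | add x y hx hy => simp only [map_add, hx, hy]
  | ι_mul m x hx =>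
    rw [map_mul, hd.leibniz_coord, hd.apply_proj, braidedDeriv_basis_mul]
    simp only [hx, quotAct_proj, map_add, map_sum, map_mul]
    congr 1
    simp only [Module.Basis.coord_apply, Module.Basis.repr_self, Finsupp.single_apply]
    split_ifs <;> simp

/-- The operators `d` live on the quotient, so the braided derivations of `T(W)` that induce them
must preserve `I`. -/
theorem le_nicholsIdeal (hd : Y.IsBraidedDerivationFamily hS I hI d)
    (hI0 : ∀ x ∈ I, (TensorAlgebra.algebraMapInv x : k) = 0) : I ≤ Y.nicholsIdeal := by
  let b := Module.finBasis k W
  refine Y.le_nicholsIdeal_of_skewDeriv_mem b I hI0 fun x hx m => ?_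
  rw [skewDeriv_eq_sum_braidedDeriv Y b hS]
  refine Submodule.sum_mem _ fun i _ => hI _ _ ?_
  refine Ideal.Quotient.eq_zero_iff_mem.mp ?_
  change proj (k := k) I _ = 0
  rw [← hd.apply_coord_proj b i, proj_eq_zero I hx, map_zero]

end IsBraidedDerivationFamily

end YetterDrinfeld

end YD

end

/-! ### The theorem. -/

theorem theorem2p9 {k H W : Type*} [Field k] [Ring H] [HopfAlgebra k H]
    (hS : Function.Bijective (HopfAlgebra.antipode k (A := H)))
    [AddCommGroup W] [Module k W] [FiniteDimensional k W] (Y : YD.YetterDrinfeld k H W)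
    (I : Ideal (TensorAlgebra k W)) [I.IsTwoSided]
    (hI_counit : ∀ x ∈ I, TensorAlgebra.algebraMapInv x = 0)
    (hI_act : Y.IsActStable I) :
    (YD.YetterDrinfeld.IsHomogeneousIdeal I → Y.IsHopfIdeal I →
      (∀ w : W, TensorAlgebra.ι k w ∈ I → w = 0) →
      ∃ d : Module.Dual k W → Module.End k (TensorAlgebra k W ⧸ I),
        Y.IsBraidedDerivationFamily hS I hI_act d) ∧
    (∀ d : Module.Dual k W → Module.End k (TensorAlgebra k W ⧸ I),
      Y.IsBraidedDerivationFamily hS I hI_act d →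
      I ≤ Y.nicholsIdeal ∧
      ∃ Ω : (TensorAlgebra k W ⧸ I) →ₐ[k] Y.NicholsAlgebra,
        Function.Surjective Ω ∧
        (∀ w : W, Ω (YD.YetterDrinfeld.proj I (TensorAlgebra.ι k w)) =
          YD.YetterDrinfeld.proj Y.nicholsIdeal (TensorAlgebra.ι k w)) ∧
        (∀ Ω' : (TensorAlgebra k W ⧸ I) →ₐ[k] Y.NicholsAlgebra,
          (∀ w : W, Ω' (YD.YetterDrinfeld.proj I (TensorAlgebra.ι k w)) =
            YD.YetterDrinfeld.proj Y.nicholsIdeal (TensorAlgebra.ι k w)) → Ω' = Ω) ∧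
        ∀ (f : Module.Dual k W) (x : TensorAlgebra k W ⧸ I),
          Ω (d f x) = Y.nicholsDeriv hS f (Ω x)) := by
  let b := Module.finBasis k W
  refine ⟨fun hhom hhopf hW => ?_, fun d hd => ?_⟩
  · refine Y.exists_isBraidedDerivationFamily b hS hI_act fun i x hx => ?_
    refine YD.YetterDrinfeld.IsActStable.braidedDeriv_mem Y b hS hI_act (fun x hx j => ?_) i hx
    exact YD.YetterDrinfeld.IsComulStable.skewDeriv_mem Y hhopf.1
      (fun x hx => YD.YetterDrinfeld.ιInv_eq_zero_of_isHomogeneousIdeal hhom hW hx) _ hx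
  · have hle := hd.le_nicholsIdeal hI_counit
    have hΩ : ∀ x, Ideal.Quotient.factorₐ k hle (YD.YetterDrinfeld.proj I x) =
        YD.YetterDrinfeld.proj Y.nicholsIdeal x := fun _ => rfl
    refine ⟨hle, Ideal.Quotient.factorₐ k hle, ?_, fun w => hΩ _, fun Ω' hΩ' => ?_,
      fun f x => ?_⟩
    · intro z
      obtain ⟨x, rfl⟩ := YD.YetterDrinfeld.proj_surjective z
      exact ⟨_, hΩ x⟩
    · have h : Ω'.comp (YD.YetterDrinfeld.proj I) =
          (Ideal.Quotient.factorₐ k hle).comp (YD.YetterDrinfeld.proj I) := by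
        ext w
        exact (hΩ' w).trans (hΩ _).symm
      ext z
      obtain ⟨x, rfl⟩ := YD.YetterDrinfeld.proj_surjective z
      exact DFunLike.congr_fun h x
    · obtain ⟨x, rfl⟩ := YD.YetterDrinfeld.proj_surjective x
      -- Expanded in coordinates, both sides are the image in `𝓑(W)` of `∑ i, f (b i) • D_i x`.
      rw [hΩ, Y.nicholsDeriv_proj b hS, hd.eq_sum b]
      simp only [map_sum, map_smul, hd.apply_coord_proj, hΩ]
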